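/- **Setting.** Let $\mathfrak g$ be a finite-dimensional complex simple Lie algebra, $\mathfrak t$ a Cartan subalgebra, $\Delta$ the root system of $(\mathfrak g,\mathfrak t)$ with root spaces $\mathfrak g_\gamma$, $\Pi$ a set of simple roots, $\Delta^+$ the positive roots, $\mathfrak b=\mathfrak t\oplus\bigoplus_{\gamma\in\Delta^+}\mathfrak g_\gamma$ and $\theta$ the highest root. For $\gamma\in\Delta$ and $\alpha\in\Pi$ let $[\gamma:\alpha]$ be the coefficient of $\alpha$ in the expression of $\gamma$ via $\Pi$. Let $(\ ,\ )$ be a Weyl-invariant inner product on the span $V$ of $\Delta$, and $\mu^\vee=2\mu/(\mu,\mu)$. *Abelian ideals and rootlets.* An abelian ideal of $\mathfrak b$ is a subspace $\mathfrak a\subset\mathfrak b$ with $[\mathfrak b,\mathfrak a]\subset\mathfrak a$ and $[\mathfrak a,\mathfrak a]=0$; put $I_{\mathfrak a}=\{\gamma\in\Delta^+\mid \mathfrak g_\gamma\subset\mathfrak a\}$. Extend $(\ ,\ )$ to $\widehat V=V\oplus\mathbb R\delta\oplus\mathbb R\lambda$ by $(\delta,V)=(\lambda,V)=(\delta,\delta)=(\lambda,\lambda)=0$,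 $(\delta,\lambda)=1$. Let $\alpha_0=\delta-\theta$, let $\widehat W\subset GL(\widehat V)$ be generated by the reflections $x\mapsto x-(x,\alpha)\alpha^\vee$ in $\alpha\in\Pi\cup\{\alpha_0\}$, let $\widehat\Delta^+=\Delta^+\cup\{\gamma+k\delta\mid\gamma\in\Delta,\ k\ge1\}$, and $\mathcal N(w)=\{\nu\in\widehat\Delta^+\mid w(\nu)\in-\widehat\Delta^+\}$ for $w\in\widehat W$. For each abelian ideal $\mathfrak a$ there is a unique $w_{\mathfrak a}\in\widehat W$ with $\mathcal N(w_{\mathfrak a})=\{\delta-\gamma\mid\gamma\in I_{\mathfrak a}\}$; if $\mathfrak a\neq0$, its rootlet is $w_{\mathfrak a}(\alpha_0)+\delta$. *Parabolics and gradings.* For a parabolic subalgebra $\mathfrak p\supset\mathfrak b$ let $S(\mathfrak p)\subset\Pi$ be the set of simple roots that are not roots of the Levi subalgebra of $\mathfrak p$ containing $\mathfrak t$. A subset $S\subset\Pi$ defines the $\mathbb Z$-grading $\mathfrak g=\bigoplus_i\mathfrak g(i;S)$ with $\mathfrak t\subset\mathfrak g(0;S)$ and $\mathfrak g_\gamma\subset\mathfrak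 g\bigl(\sum_{\alpha\in S}[\gamma:\alpha];S\bigr)$; put $\mathfrak g(\ge j;S)=\bigoplus_{i\ge j}\mathfrak g(i;S)$. The height of $\mathfrak p$ is the largest $i$ with $\mathfrak g(i;S(\mathfrak p))\ne0$. **Theorem 4.1.** Suppose that $\theta$ is fundamental, i.e. $(\theta,\alpha^\vee)=1$ for one simple root $\alpha$ and $(\theta,\beta^\vee)=0$ for all other simple roots $\beta$, and let $\alpha_\theta\in\Pi$ be the simple root with $(\theta,\alpha_\theta)\neq0$. Then there is exactly one nonzero abelian ideal of $\mathfrak b$ with rootlet $\alpha_\theta$. Denote it by $\mathfrak a(\alpha_\theta)$; it is a maximal abelian ideal of $\mathfrak b$. Let $\mathfrak p[\alpha_\theta]$ be its normaliser in $\mathfrak g$ and $\mathcal S[\alpha_\theta]=S(\mathfrak p[\alpha_\theta])$. Then 1. $\mathcal S[\alpha_\theta]=\{\beta\in\Pi\setminus\{\alpha_\theta\}\mid(\beta,\alpha_\theta)\ne0\}$, the set of all simple roots adjacent to $\alpha_\theta$; 2. $\alpha_\theta$ is long, $[\theta:\alpha_\theta]=2$, and the height of $\mathfrak p[\alpha_\theta]$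 is $3$; 3. $\mathfrak a(\alpha_\theta)=\mathfrak g(\ge2;\mathcal S[\alpha_\theta])$. -/

import Mathlib

open LieAlgebra LieAlgebra.IsKilling

noncomputable section

namespace AbelianIdeals

section RootSystem

variable {ι K M N : Type*} [Fintype ι] [Field K] [CharZero K] [AddCommGroup M] [Module K M]
  [AddCommGroup N] [Module K N] {P : RootPairing ι K M N} [P.IsRootSystem]

/-- `θ` is the highest root: `θ - γ` is a non-negative integral combination of simple roots
for every root `γ`. -/
def IsHighestRoot (b : P.Base) (θ : ι) : Prop :=
  ∀ γ : ι, P.root θ - P.root γ ∈ AddSubmonoid.closure (P.root '' b.support)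

/-- The root `γ` is a fundamental weight: for some simple root `α`, one has
`⟨γ, α^∨⟩ = 1` and `⟨γ, β^∨⟩ = 0` for all other simple roots `β`. -/
def IsFundamental (b : P.Base) (γ : ι) : Prop :=
  ∃ α ∈ b.support, P.pairing γ α = 1 ∧ ∀ β ∈ b.support, β ≠ α → P.pairing γ β = 0

/-- The root `γ` has maximal length with respect to the canonical Weyl-invariant
positive definite form on the span of the roots. -/
def IsLong (P : RootPairing ι K M N) [P.IsCrystallographic] (γ : ι) : Prop :=
  ∀ β : ι, (P.posRootForm ℤ).rootLength β ≤ (P.posRootForm ℤ).rootLength γ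

/-- `[γ : α]`, the coefficient of the simple root `α` in the expression of the root `γ` through
the simple roots. -/
def coeff (b : P.Base) (γ : ι) (α : b.support) : ℤ :=
  b.toWeightBasisInt.repr (P.rootSpanMem ℤ γ) α

open scoped Classical in
/-- The degree of the root `γ`, when the simple roots in `S` have degree `1` and the
other simple roots have degree `0`. -/
def deg (b : P.Base) (S : Set ι) (γ : ι) : ℤ :=
  ∑ α : b.support, if (α : ι) ∈ S then coeff b γ α else 0

/-! ### The affine Weyl group -/

variable (K M) in
/-- The space `V ⊕ K δ ⊕ K λ`; the triple `(v, r, s)` stands for `v + r δ + s λ`. -/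
abbrev VHat : Type _ := M × K × K

variable (P) in
/-- The symmetric bilinear form on `V ⊕ K δ ⊕ K λ` that extends the Weyl-invariant form on `V`, with
`(δ, V) = (λ, V) = (δ, δ) = (λ, λ) = 0` and `(δ, λ) = 1`. -/
def formHat : LinearMap.BilinForm K (VHat K M) :=
  let v : VHat K M →ₗ[K] M := LinearMap.fst K M (K × K)
  let r : VHat K M →ₗ[K] K := (LinearMap.fst K K K).comp (LinearMap.snd K M (K × K))
  let s : VHat K M →ₗ[K] K := (LinearMap.snd K K K).comp (LinearMap.snd K M (K × K))
  P.RootForm.compl₁₂ v v + (LinearMap.mul K K).compl₁₂ r s + (LinearMap.mul K K).compl₁₂ s r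

variable (K M) in
/-- The element `δ`. -/
def delta : VHat K M := (0, 1, 0)

variable (P) in
/-- The root `γ`, as an element of `V ⊕ K δ ⊕ K λ`. -/
def rootHat (γ : ι) : VHat K M := (P.root γ, 0, 0)

variable (P) in
/-- The affine simple root `α₀ = δ - θ`. -/
def alphaZero (θ : ι) : VHat K M := delta K M - rootHat P θ

/-- The affine simple roots. -/
def simpleHat (b : P.Base) (θ : ι) : Set (VHat K M) :=
  insert (alphaZero P θ) (rootHat P '' b.support)

/-- The positive affine real roots: `γ` with `γ` a positive root, and `γ + k δ`
with `γ` any root and `k ≥ 1`. -/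
def posHat (b : P.Base) : Set (VHat K M) :=
  {x | ∃ γ : ι, b.IsPos γ ∧ x = rootHat P γ} ∪
    {x | ∃ (γ : ι) (k : ℕ), 1 ≤ k ∧ x = rootHat P γ + k • delta K M}

variable (P) in
/-- The reflection `x ↦ x - (α, x) α^∨`, where `α^∨ = 2 α / (α, α)`. -/
def reflHat (α : VHat K M) : VHat K M →ₗ[K] VHat K M :=
  Module.preReflection ((2 / formHat P α α) • α) (formHat P α)

/-- The affine Weyl group, the subgroup of `GL(V ⊕ K δ ⊕ K λ)` generated by the
reflections in the affine simple roots. -/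
def affineWeylGroup (b : P.Base) (θ : ι) : Subgroup (VHat K M ≃ₗ[K] VHat K M) :=
  Subgroup.closure {g | ∃ α ∈ simpleHat b θ, (g : VHat K M →ₗ[K] VHat K M) = reflHat P α}

/-- The inversion set of `w`: the positive affine roots that `w` makes negative. -/
def inversionSet (b : P.Base) (w : VHat K M ≃ₗ[K] VHat K M) : Set (VHat K M) :=
  {x | x ∈ posHat b ∧ -(w x) ∈ posHat b}

/-- `w` is the minuscule element of the affine Weyl group that corresponds to the
set of roots `I`. -/
def IsMinusculeFor (b : P.Base) (θ : ι) (w : VHat K M ≃ₗ[K] VHat K M) (I : Set ι) : Prop :=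
  w ∈ affineWeylGroup b θ ∧ inversionSet b w = {x | ∃ γ ∈ I, x = delta K M - rootHat P γ}

end RootSystem

section LieAlgebra

variable {L : Type*} [LieRing L] [LieAlgebra ℂ L] [FiniteDimensional ℂ L]
  [LieAlgebra.IsSimple ℂ L] {H : LieSubalgebra ℂ L} [H.IsCartanSubalgebra]

/-- The root space of the root `γ`, as a subspace of the Lie algebra. -/
def rootSubspace (γ : H.root) : Submodule ℂ L :=
  (rootSpace H (γ : LieModule.Weight ℂ H L)).toSubmodule

/-- The Borel subalgebra: the sum of the Cartan subalgebra and the positive root spaces. -/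
def borel (b : (rootSystem H).Base) : Submodule ℂ L :=
  H.toSubmodule ⊔ ⨆ (γ : H.root) (_ : b.IsPos γ), rootSubspace γ

/-- `a` is an abelian ideal of the Borel subalgebra. -/
structure IsAbelianIdeal (b : (rootSystem H).Base) (a : LieSubalgebra ℂ L) : Prop where
  le_borel : a.toSubmodule ≤ borel b
  lie_mem : ∀ x ∈ borel b, ∀ y ∈ a, ⁅x, y⁆ ∈ a
  lie_eq_zero : ∀ x ∈ a, ∀ y ∈ a, ⁅x, y⁆ = 0

/-- The set of positive roots whose root space lies in `a`. -/
def rootsOf (b : (rootSystem H).Base) (a : LieSubalgebra ℂ L) : Set H.root :=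
  {γ | b.IsPos γ ∧ rootSubspace γ ≤ a.toSubmodule}

/-- `μ` is the rootlet of `a`: `μ = w(α₀) + δ` for the minuscule element `w` that corresponds
to `a`. -/
def IsRootlet (b : (rootSystem H).Base) (θ : H.root) (a : LieSubalgebra ℂ L) (μ : H.root) : Prop :=
  ∃ w, IsMinusculeFor b θ w (rootsOf b a) ∧
    w (alphaZero (rootSystem H) θ) + delta ℂ (Module.Dual ℂ H) = rootHat (rootSystem H) μ

/-- The set of nonzero abelian ideals of the Borel subalgebra with rootlet `μ`. -/
def abelianIdealsWithRootlet (b : (rootSystem H).Base) (θ μ : H.root) : Set (LieSubalgebra ℂ L) :=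
  {a | IsAbelianIdeal b a ∧ a ≠ ⊥ ∧ IsRootlet b θ a μ}

/-- The standard Levi subalgebra of a standard parabolic subalgebra `p`: the sum of the Cartan
subalgebra and the root spaces of those `γ` for which both `γ` and `-γ` are roots of `p`. -/
def standardLevi (p : LieSubalgebra ℂ L) : Submodule ℂ L :=
  H.toSubmodule ⊔ ⨆ (γ : H.root) (_ : rootSubspace γ ≤ p.toSubmodule ∧
    (rootSpace H (-(γ : LieModule.Weight ℂ H L))).toSubmodule ≤ p.toSubmodule), rootSubspace γ

/-- The set `S(p)` of simple roots that are not roots of the standard Levi subalgebra of `p`. -/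
def simpleRootsOff (b : (rootSystem H).Base) (p : LieSubalgebra ℂ L) : Set H.root :=
  {α | α ∈ b.support ∧ ¬ rootSubspace α ≤ standardLevi (H := H) p}

open scoped Classical in
/-- The component `g(i; S)` of the `ℤ`-grading defined by the set `S` of simple roots. -/
def gradingPiece (b : (rootSystem H).Base) (S : Set H.root) (i : ℤ) : Submodule ℂ L :=
  (if i = 0 then H.toSubmodule else ⊥) ⊔ ⨆ (γ : H.root) (_ : deg b S γ = i), rootSubspace γ

/-- `g(≥ j; S)`, the sum of the components of degree at least `j`. -/
def gradingGE (b : (rootSystem H).Base) (S : Set H.root) (j : ℤ) : Submodule ℂ L :=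
  ⨆ (i : ℤ) (_ : j ≤ i), gradingPiece b S i

/-- The height of the grading defined by `S` is `h`: the largest `i` with `g(i; S) ≠ 0`. -/
def HasHeight (b : (rootSystem H).Base) (S : Set H.root) (h : ℤ) : Prop :=
  IsGreatest {i : ℤ | gradingPiece b S i ≠ ⊥} h

end LieAlgebra

end AbelianIdeals

end

/-! Write ⟨γ, β⟩ for the pairing of γ with the coroot of β, α for the simple root of the theorem,
and S for the set of simple roots adjacent to it. Fundamentality makes α as long as θ, with ⟨α, θ⟩ =
1. Everything then rests on a formula checked on simple roots (`deg_eq`): the S-degree of γ is 2⟨γ,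
θ⟩ - ⟨γ, α⟩. A root pairs with a long root other than ± itself to a value in {-1, 0, 1}, so few
pairs (⟨γ, θ⟩, ⟨γ, α⟩) occur for positive γ (`isPos_cases`). In particular degrees are at most 3,
attained at θ, and the part of degree at least 2 is an abelian ideal.

Rootlets. An element w of the affine Weyl group sends γ + rδ to e(γ) + (r + n(γ))δ, where e
preserves pairings and n lies in the coroot lattice. The minuscule condition bounds n and determines
I from (e, n); rootlet α means e(θ) = -α and n(θ) = 2. Compare n with ⟨·, θ⟩: their difference,
transported by e, has absolute value at most 1 on every root, and the coroot lattice has no nonzero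
element of this kind. Hence n = ⟨·, θ⟩ (`translation_eq`). Positivity of e on the positive roots
orthogonal to θ then gives e(α) = -θ (`root_apply_eq_neg`), so the pairings of e(γ) with θ and α are
known, and I is exactly the set of roots of degree at least 2 (`two_le_deg_iff`). An abelian ideal
is the sum of its root spaces, so uniqueness follows. For existence take w = t s₀, where s₀ is the
reflection in δ - θ and t is a finite Weyl element with t(θ) = α that keeps the positive roots
orthogonal to θ positive.

Maximality. In a larger abelian ideal a root of degree at most 1 could be raised, if necessary, to a
root γ of degree at most 1 with ⟨γ, θ⟩ = 1 (`exists_raise`). Then θ - γ is a root of degree at least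
2, so both lie in the ideal although their sum is a root.

Normaliser. It contains all root spaces of nonnegative degree, while for β in S the root -β lowers
some root of degree 2 to a root of degree 1 (`exists_root_sub_adjacent`), so it is excluded. -/

noncomputable section

namespace AbelianIdeals

set_option linter.unusedSectionVars false

/-! ### Integer-valued linear functions on the roots: pairings, coefficients, heights, degrees. -/

section RootLinear

variable {ι K M N : Type*} [Field K] [CharZero K] [AddCommGroup M] [Module K M]
  [AddCommGroup N] [Module K N] {P : RootPairing ι K M N}

variable (P) in
/-- An integer valued function on the roots that extends to a linear form on the root lattice. -/
def RootLinear (F : ι → ℤ) : Prop :=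
  ∃ φ : P.rootSpan ℤ →ₗ[ℤ] ℤ, ∀ i, F i = φ (P.rootSpanMem ℤ i)

lemma RootLinear.eq_sum {κ : Type*} {F : ι → ℤ} (hF : RootLinear P F) {s : Finset κ} {a : κ → ℤ}
    {f : κ → ι} {k : ι} (h : P.root k = ∑ j ∈ s, a j • P.root (f j)) :
    F k = ∑ j ∈ s, a j * F (f j) := by
  obtain ⟨φ, hφ⟩ := hF
  have : P.rootSpanMem ℤ k = ∑ j ∈ s, a j • P.rootSpanMem ℤ (f j) := by
    apply Subtype.ext
    simpa using h
  rw [hφ, this, map_sum]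
  simp only [map_smul, smul_eq_mul, hφ]

lemma RootLinear.eq_add {F : ι → ℤ} (hF : RootLinear P F) {i j k : ι}
    (h : P.root k = P.root i + P.root j) : F k = F i + F j := by
  have := hF.eq_sum (s := Finset.univ) (a := fun _ : Bool ↦ 1) (f := fun x ↦ cond x i j) (k := k)
    (by simp [h])
  simpa using this

lemma RootLinear.eq_sub {F : ι → ℤ} (hF : RootLinear P F) {i j k : ι}
    (h : P.root k = P.root i - P.root j) : F k = F i - F j := by
  have := hF.eq_add (show P.root i = P.root k + P.root j by simp [h])
  omega

lemma RootLinear.eq_neg {F : ι → ℤ} (hF : RootLinear P F) {i k : ι}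
    (h : P.root k = -P.root i) : F k = - F i := by
  have := hF.eq_sum (s := Finset.univ) (a := fun _ : Unit ↦ -1) (f := fun _ ↦ i) (k := k)
    (by simp [h])
  simpa using this

lemma RootLinear.reflectionPerm_self {F : ι → ℤ} (hF : RootLinear P F) (i : ι) :
    F (P.reflectionPerm i i) = - F i :=
  hF.eq_neg (by simp)

lemma RootLinear.reflectionPerm [P.IsCrystallographic] {F : ι → ℤ} (hF : RootLinear P F) (i j : ι) :
    F (P.reflectionPerm j i) = F i - P.pairingIn ℤ i j * F j := by
  have := hF.eq_sum (s := Finset.univ) (a := fun x : Bool ↦ cond x 1 (-P.pairingIn ℤ i j))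
    (f := fun x ↦ cond x i j) (k := P.reflectionPerm j i)
    (by
      rw [P.root_reflectionPerm, P.reflection_apply_root' ℤ]
      simp [sub_eq_add_neg])
  simpa [sub_eq_add_neg] using this

lemma RootLinear.add {F G : ι → ℤ} (hF : RootLinear P F) (hG : RootLinear P G) :
    RootLinear P (F + G) := by
  obtain ⟨φ, hφ⟩ := hF
  obtain ⟨ψ, hψ⟩ := hG
  exact ⟨φ + ψ, fun i ↦ by simp [hφ, hψ]⟩

lemma RootLinear.neg {F : ι → ℤ} (hF : RootLinear P F) : RootLinear P (-F) := by
  obtain ⟨φ, hφ⟩ := hF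
  exact ⟨-φ, fun i ↦ by simp [hφ]⟩

lemma RootLinear.zero : RootLinear P 0 := ⟨0, by simp⟩

lemma RootLinear.sum {κ : Type*} {s : Finset κ} {F : κ → ι → ℤ} (hF : ∀ k, RootLinear P (F k)) :
    RootLinear P (fun i ↦ ∑ k ∈ s, F k i) := by
  choose φ hφ using hF
  exact ⟨∑ k ∈ s, φ k, fun i ↦ by simp [hφ]⟩

lemma rootLinear_pairingIn [P.IsCrystallographic] (j : ι) :
    RootLinear P (fun i ↦ P.pairingIn ℤ i j) :=
  ⟨P.coroot'In ℤ j, fun i ↦ (P.coroot'In_rootSpanMem_eq_pairingIn j i ℤ).symm⟩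

lemma rootLinear_coeff (b : P.Base) (α : b.support) : RootLinear P (fun i ↦ coeff b i α) :=
  ⟨b.toWeightBasisInt.coord α, fun i ↦ by simp [coeff]⟩

lemma root_eq_sum_coeff (b : P.Base) (i : ι) :
    P.root i = ∑ j : b.support, coeff b i j • P.root j := by
  have := congrArg (Subtype.val) (b.toWeightBasisInt.sum_repr (P.rootSpanMem ℤ i))
  simpa [coeff] using this.symm

lemma RootLinear.eq_sum_coeff {F : ι → ℤ} (hF : RootLinear P F) (b : P.Base) (i : ι) :
    F i = ∑ j : b.support, coeff b i j * F j :=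
  hF.eq_sum (root_eq_sum_coeff b i)

open scoped Classical in
lemma coeff_support (b : P.Base) (i j : b.support) :
    coeff b i j = if i = j then 1 else 0 := by
  have : P.rootSpanMem ℤ i = b.toWeightBasisInt i := Subtype.ext (by simp)
  rw [coeff, this]
  simp [Finsupp.single_apply]

lemma height_eq_sum_coeff (b : P.Base) (i : ι) : b.height i = ∑ j : b.support, coeff b i j := by
  obtain ⟨f, -, -, hf⟩ := b.exists_root_eq_sum_int i
  rw [RootPairing.Base.height_eq_sum hf]
  rw [← Finset.sum_coe_sort] at hf
  rw [← Finset.sum_coe_sort b.support]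
  refine Finset.sum_congr rfl fun j _ ↦ ?_
  rw [(rootLinear_coeff b j).eq_sum hf]
  simp [coeff_support]

lemma rootLinear_height (b : P.Base) : RootLinear P b.height := by
  rw [funext (height_eq_sum_coeff b)]
  exact .sum fun j ↦ rootLinear_coeff b j

lemma rootLinear_deg (b : P.Base) (S : Set ι) : RootLinear P (deg b S) := by
  classical
  refine .sum (F := fun (j : b.support) i ↦ if (j : ι) ∈ S then coeff b i j else 0) fun j ↦ ?_
  by_cases hj : (j : ι) ∈ S
  · simpa [hj] using rootLinear_coeff b j
  · simpa [hj] using! RootLinear.zero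

lemma coeff_nonneg {b : P.Base} {i : ι} (hi : b.IsPos i) (j : b.support) : 0 ≤ coeff b i j := by
  obtain ⟨f, -, hf', hf⟩ := b.exists_root_eq_sum_int i
  have hh := RootPairing.Base.height_eq_sum hf
  rw [← Finset.sum_coe_sort] at hf
  have : coeff b i j = f j := by
    rw [(rootLinear_coeff b j).eq_sum hf]
    simp [coeff_support]
  rw [this]
  rcases hf' with h | h
  · exact h.le _
  · have : b.height i ≤ 0 := hh ▸ Finset.sum_nonpos fun k _ ↦ h.le k
    have := b.isPos_iff.mp hi
    omega

lemma isPos_reflectionPerm_self_iff {b : P.Base} {i : ι} :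
    b.IsPos (P.reflectionPerm i i) ↔ ¬ b.IsPos i :=
  RootPairing.Base.IsPos.neg_iff_not b i

lemma isPos_neg_iff {b : P.Base} {i k : ι} (h : P.root k = -P.root i) :
    b.IsPos k ↔ ¬ b.IsPos i := by
  rw [← isPos_reflectionPerm_self_iff (b := b) (i := i)]
  have : k = P.reflectionPerm i i := P.root.injective (by simp [h])
  rw [this]

/-- A linear form that is nonnegative on the simple roots is nonnegative on the positive roots. -/
lemma RootLinear.nonneg_of_isPos {F : ι → ℤ} (hF : RootLinear P F) {b : P.Base}
    (h : ∀ j ∈ b.support, 0 ≤ F j) {i : ι} (hi : b.IsPos i) : 0 ≤ F i := by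
  rw [hF.eq_sum_coeff b]
  exact Finset.sum_nonneg fun j _ ↦ mul_nonneg (coeff_nonneg hi j) (h j j.2)

lemma RootLinear.isPos_of_pos {F : ι → ℤ} (hF : RootLinear P F) {b : P.Base}
    (h : ∀ j ∈ b.support, 0 ≤ F j) {i : ι} (hi : 0 < F i) : b.IsPos i := by
  by_contra hn
  have := hF.nonneg_of_isPos h (isPos_reflectionPerm_self_iff.mpr hn)
  rw [hF.reflectionPerm_self] at this
  omega

/-- Membership of θ - γ in the monoid generated by the simple roots is turned into nonnegative
coordinates by induction on the closure. The induction carries membership in the root lattice along,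
since the coordinates are only defined there. -/
lemma IsHighestRoot.coeff_le [Fintype ι] {b : P.Base} {θ : ι}
    (hθ : IsHighestRoot b θ) (i : ι) (j : b.support) : coeff b i j ≤ coeff b θ j := by
  have key : ∀ x ∈ AddSubmonoid.closure (P.root '' b.support),
      ∃ hx : x ∈ P.rootSpan ℤ, 0 ≤ b.toWeightBasisInt.repr ⟨x, hx⟩ j := by
    intro x hx
    induction hx using AddSubmonoid.closure_induction with
    | mem x hx =>
      obtain ⟨i, hi, rfl⟩ := hx
      exact ⟨(P.rootSpanMem ℤ i).2, coeff_nonneg (b.isPos_of_mem_support hi) j⟩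
    | zero => exact ⟨zero_mem _, le_of_eq (by
        rw [show (⟨0, zero_mem _⟩ : P.rootSpan ℤ) = 0 from rfl]; simp)⟩
    | add x y _ _ hx hy =>
      obtain ⟨hx, hx'⟩ := hx
      obtain ⟨hy, hy'⟩ := hy
      refine ⟨add_mem hx hy, ?_⟩
      rw [show (⟨x + y, add_mem hx hy⟩ : P.rootSpan ℤ) = ⟨x, hx⟩ + ⟨y, hy⟩ from rfl]
      rw [map_add]
      exact add_nonneg hx' hy'
  obtain ⟨hx, hx'⟩ := key _ (hθ i)
  rw [show (⟨P.root θ - P.root i, hx⟩ : P.rootSpan ℤ) =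
    P.rootSpanMem ℤ θ - P.rootSpanMem ℤ i from rfl] at hx'
  simpa [coeff] using hx'

end RootLinear

/-! ### The coroot lattice contains no nonzero minuscule element. -/

section Minuscule

variable {ι K M N : Type*} [Fintype ι] [Field K] [CharZero K] [AddCommGroup M] [Module K M]
  [AddCommGroup N] [Module K N] {P : RootPairing ι K M N} [P.IsCrystallographic]

variable (P) in
/-- The functions on the roots that come from the coroot lattice. -/
def corootLattice : AddSubgroup (ι → ℤ) :=
  AddSubgroup.closure (Set.range fun j i ↦ P.pairingIn ℤ i j)

omit [Fintype ι] in
lemma pairingIn_mem_corootLattice (j : ι) : (fun i ↦ P.pairingIn ℤ i j) ∈ corootLattice P :=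
  AddSubgroup.subset_closure ⟨j, rfl⟩

omit [Fintype ι] in
lemma rootLinear_of_mem_corootLattice {F : ι → ℤ} (hF : F ∈ corootLattice P) : RootLinear P F := by
  induction hF using AddSubgroup.closure_induction with
  | mem x hx => obtain ⟨j, rfl⟩ := hx; exact rootLinear_pairingIn j
  | zero => exact .zero
  | add x y _ _ hx hy => exact hx.add hy
  | neg x _ hx => exact hx.neg

omit [Fintype ι] in
lemma comp_mem_corootLattice {F : ι → ℤ} (hF : F ∈ corootLattice P) {e : Equiv.Perm ι}
    (he : ∀ i j, P.pairingIn ℤ (e i) (e j) = P.pairingIn ℤ i j) : F ∘ e ∈ corootLattice P := by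
  induction hF using AddSubgroup.closure_induction with
  | mem x hx =>
    obtain ⟨j, rfl⟩ := hx
    convert pairingIn_mem_corootLattice (P := P) (e.symm j) using 1
    ext i
    rw [Function.comp_apply, ← he i (e.symm j), e.apply_symm_apply]
  | zero => exact zero_mem _
  | add x y _ _ hx hy => exact add_mem hx hy
  | neg x _ hx => exact neg_mem hx

/-- Reindexing the sum by the reflection in `j` replaces each term by its negative plus `F j` times
a square. This plays the role of the identity 2(F, j^∨) = F(j)(j^∨, j^∨) for the invariant form on
coroots. -/
lemma two_mul_sum_mul_pairingIn {F : ι → ℤ} (hF : RootLinear P F) (j : ι) :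
    2 * ∑ i, F i * P.pairingIn ℤ i j = F j * ∑ i, P.pairingIn ℤ i j ^ 2 := by
  have h : ∑ i, F i * P.pairingIn ℤ i j =
      ∑ i, F (P.reflectionPerm j i) * P.pairingIn ℤ (P.reflectionPerm j i) j :=
    (Equiv.sum_comp (P.reflectionPerm j) fun i ↦ F i * P.pairingIn ℤ i j).symm
  have h2 (i : ι) : F (P.reflectionPerm j i) * P.pairingIn ℤ (P.reflectionPerm j i) j =
      - (F i * P.pairingIn ℤ i j) + F j * P.pairingIn ℤ i j ^ 2 := by
    rw [hF.reflectionPerm, (rootLinear_pairingIn j).reflectionPerm, P.pairingIn_same]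
    ring
  simp only [h2, Finset.sum_add_distrib, Finset.sum_neg_distrib, ← Finset.mul_sum] at h
  omega

-- Coefficients and signs disappear because the negative of a coroot is again a coroot; the length
-- of the list is what the next induction runs on.
omit [Fintype ι] in
lemma exists_list_of_mem_corootLattice {F : ι → ℤ} (hF : F ∈ corootLattice P) :
    ∃ l : List ι, ∀ i, F i = (l.map fun j ↦ P.pairingIn ℤ i j).sum := by
  induction hF using AddSubgroup.closure_induction with
  | mem x hx => obtain ⟨j, rfl⟩ := hx; exact ⟨[j], by simp⟩
  | zero => exact ⟨[], by simp⟩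
  | add x y _ _ hx hy =>
    obtain ⟨l, hl⟩ := hx
    obtain ⟨l', hl'⟩ := hy
    exact ⟨l ++ l', fun i ↦ by simp [hl, hl']⟩
  | neg x _ hx =>
    obtain ⟨l, hl⟩ := hx
    refine ⟨l.map fun j ↦ P.reflectionPerm j j, fun i ↦ ?_⟩
    simp only [Pi.neg_apply, hl, List.map_map]
    clear hl
    induction l with
    | nil => simp
    | cons j l ih => simp_all [add_comm]

/-- If F(j) > 0 for some coroot j^∨ in the list, then F(j) = 1 and reflecting F in j removes that
coroot, leaving a shorter list with the same bound. Otherwise every coroot in the list has F(j) ≤ 0,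
so the squared norm of F, expanded along the list, is at most 0. -/
lemma list_sum_eq_zero_of_abs_le_one (n : ℕ) : ∀ l : List ι, l.length = n →
    (∀ i, |(l.map fun j ↦ P.pairingIn ℤ i j).sum| ≤ 1) →
    ∀ i, (l.map fun j ↦ P.pairingIn ℤ i j).sum = 0 := by
  classical
  induction n with
  | zero => intro l hl; simp [List.length_eq_zero_iff.mp hl]
  | succ n ih =>
    intro l hl hb
    set F : ι → ℤ := fun i ↦ (l.map fun j ↦ P.pairingIn ℤ i j).sum with hFdef
    have hFlin : ∀ l : List ι, RootLinear P fun i ↦ (l.map fun j ↦ P.pairingIn ℤ i j).sum := by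
      intro l
      induction l with
      | nil => exact .zero
      | cons j l ih => simpa only [List.map_cons, List.sum_cons] using! (rootLinear_pairingIn j).add ih
    have hF : RootLinear P F := hFlin l
    by_cases hpos : ∃ j ∈ l, 0 < F j
    · obtain ⟨j, hj, hjF⟩ := hpos
      have hj1 : F j = 1 := by exact le_antisymm (abs_le.mp (hb j)).2 hjF
      have hperm := List.perm_cons_erase hj
      have herase (i : ι) : ((l.erase j).map fun j ↦ P.pairingIn ℤ i j).sum =
          F (P.reflectionPerm j i) := by
        rw [hF.reflectionPerm, hj1, hFdef]
        simp only
        rw [(hperm.map _).sum_eq]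
        simp
      have h0 := ih (l.erase j) (by rw [List.length_erase_of_mem hj, hl]; rfl)
        (fun i ↦ by rw [herase]; exact hb _)
      intro i
      have := h0 (P.reflectionPerm j i)
      rw [herase] at this
      simpa using this
    · push Not at hpos
      -- One factor F of the square is expanded along the list, so that `two_mul_sum_mul_pairingIn`
      -- applies to each term.
      have hsq : ∑ i, F i ^ 2 = (l.map fun j ↦ ∑ i, F i * P.pairingIn ℤ i j).sum := by
        have : ∀ l : List ι, ∑ i, F i * (l.map fun j ↦ P.pairingIn ℤ i j).sum =
            (l.map fun j ↦ ∑ i, F i * P.pairingIn ℤ i j).sum := by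
          intro l
          induction l with
          | nil => simp
          | cons j l ih => simp [mul_add, Finset.sum_add_distrib, ih]
        rw [← this l]
        simp [pow_two, hFdef]
      have hle : ∑ i, F i ^ 2 ≤ 0 := by
        rw [hsq]
        rw [← neg_nonneg, List.sum_neg]
        refine List.sum_nonneg fun x hx ↦ ?_
        simp only [List.map_map, List.mem_map, Function.comp_apply] at hx
        obtain ⟨j, hj, rfl⟩ := hx
        have h1 := two_mul_sum_mul_pairingIn hF j
        have h2 : F j * ∑ i, P.pairingIn ℤ i j ^ 2 ≤ 0 :=
          mul_nonpos_of_nonpos_of_nonneg (hpos j hj) (Finset.sum_nonneg fun _ _ ↦ sq_nonneg _)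
        omega
      have h0 := (Finset.sum_eq_zero_iff_of_nonneg (fun i _ ↦ sq_nonneg (F i))).mp
        (le_antisymm hle (Finset.sum_nonneg fun _ _ ↦ sq_nonneg _))
      intro i
      simpa using h0 i (Finset.mem_univ i)

/-- The coroot lattice contains no nonzero minuscule element. -/
lemma eq_zero_of_mem_corootLattice_of_abs_le_one {F : ι → ℤ} (hF : F ∈ corootLattice P)
    (h : ∀ i, |F i| ≤ 1) (i : ι) : F i = 0 := by
  obtain ⟨l, hl⟩ := exists_list_of_mem_corootLattice hF
  rw [hl]
  exact list_sum_eq_zero_of_abs_le_one _ l rfl (fun i ↦ hl i ▸ h i) i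

end Minuscule

/-! ### Combinatorics of roots relative to a fundamental highest root. -/

section HighestRoot

variable {ι K M N : Type*} [Fintype ι] [Field K] [CharZero K] [AddCommGroup M] [Module K M]
  [AddCommGroup N] [Module K N] {P : RootPairing ι K M N} [P.IsCrystallographic]
  {b : P.Base} {θ α : ι}

lemma rootLength_reflectionPerm (i j : ι) :
    (P.posRootForm ℤ).rootLength (P.reflectionPerm j i) = (P.posRootForm ℤ).rootLength i := by
  apply FaithfulSMul.algebraMap_injective ℤ K
  simp only [RootPairing.RootPositiveForm.algebraMap_rootLength, P.root_reflectionPerm]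
  exact (P.posRootForm ℤ).isOrthogonal_reflection j _ _

lemma RootLinear.le_of_isHighestRoot {F : ι → ℤ} (hF : RootLinear P F) (hθ : IsHighestRoot b θ)
    (h : ∀ j ∈ b.support, 0 ≤ F j) (i : ι) : F i ≤ F θ := by
  rw [hF.eq_sum_coeff b i, hF.eq_sum_coeff b θ]
  exact Finset.sum_le_sum fun j _ ↦ mul_le_mul_of_nonneg_right (hθ.coeff_le i j) (h j j.2)

lemma IsHighestRoot.isPos (hθ : IsHighestRoot b θ) : b.IsPos θ := by
  have := (rootLinear_height b).le_of_isHighestRoot hθ (fun j hj ↦ by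
    rw [RootPairing.Base.height_one_of_mem_support hj]; norm_num) (P.reflectionPerm θ θ)
  rw [(rootLinear_height b).reflectionPerm_self] at this
  rw [b.isPos_iff']
  omega

/-- Among the roots as long as `i`, one of maximal height, `j`, is dominant, since a simple
reflection cannot raise it. As θ dominates `j` and both are dominant, ⟨θ, j⟩ ≥ 2 and ⟨j, θ⟩ ≤ 2, and
the ratio of these pairings is the ratio of squared lengths. -/
lemma IsHighestRoot.rootLength_le (hθ : IsHighestRoot b θ)
    (hdom : ∀ β ∈ b.support, 0 ≤ P.pairingIn ℤ θ β) (i : ι) :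
    (P.posRootForm ℤ).rootLength i ≤ (P.posRootForm ℤ).rootLength θ := by
  classical
  obtain ⟨j, hj, hmax⟩ := Finset.exists_max_image
    (Finset.univ.filter fun j ↦ (P.posRootForm ℤ).rootLength j = (P.posRootForm ℤ).rootLength i)
    b.height ⟨i, by simp⟩
  simp only [Finset.mem_filter, Finset.mem_univ, true_and] at hj hmax
  have hjdom : ∀ β ∈ b.support, 0 ≤ P.pairingIn ℤ j β := by
    intro β hβ
    have := hmax (P.reflectionPerm β j) (by rw [rootLength_reflectionPerm, hj])
    rw [(rootLinear_height b).reflectionPerm,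
      RootPairing.Base.height_one_of_mem_support hβ] at this
    linarith
  have nonneg_swap (k l : ι) : 0 ≤ P.pairingIn ℤ k l → 0 ≤ P.pairingIn ℤ l k := by
    intro h
    by_contra! h'
    exact absurd ((P.pairingIn_lt_zero_iff ℤ).mp h') (not_lt.mpr h)
  have h1 := (rootLinear_pairingIn (P := P) j).le_of_isHighestRoot hθ
    (fun β hβ ↦ nonneg_swap _ _ (hjdom β hβ)) j
  have h2 := (rootLinear_pairingIn (P := P) θ).le_of_isHighestRoot hθ
    (fun β hβ ↦ nonneg_swap _ _ (hdom β hβ)) j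
  simp only [P.pairingIn_same] at h1 h2
  have h3 := (P.posRootForm ℤ).pairingIn_mul_eq_pairingIn_mul_swap θ j
  rw [← hj]
  have hθ0 := (P.posRootForm ℤ).rootLength_pos θ
  have hj0 := (P.posRootForm ℤ).rootLength_pos j
  nlinarith

variable (b θ α) in
/-- `θ` is the highest root, and it is the fundamental weight of the simple root `α`. -/
structure IsFundamentalHighest : Prop where
  highest : IsHighestRoot b θ
  mem : α ∈ b.support
  pairing_eq : P.pairingIn ℤ θ α = 1
  pairing_zero : ∀ β ∈ b.support, β ≠ α → P.pairingIn ℤ θ β = 0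

variable (b α) in
/-- The simple roots adjacent to `α`. -/
def adjacent : Set ι := {β | β ∈ b.support ∧ β ≠ α ∧ P.pairing β α ≠ 0}

lemma pairingIn_eq_zero_comm {i j : ι} : P.pairingIn ℤ i j = 0 ↔ P.pairingIn ℤ j i = 0 := by
  constructor <;> intro h <;> by_contra h' <;>
    rcases lt_or_gt_of_ne h' with h' | h'
  · have := (P.pairingIn_lt_zero_iff ℤ).mp h'; omega
  · have := (P.zero_lt_pairingIn_iff' ℤ).mp h'; omega
  · have := (P.pairingIn_lt_zero_iff ℤ).mp h'; omega
  · have := (P.zero_lt_pairingIn_iff' ℤ).mp h'; omega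

namespace IsFundamentalHighest

variable (h : IsFundamentalHighest b θ α)

include h

lemma rootLength_le (i : ι) :
    (P.posRootForm ℤ).rootLength i ≤ (P.posRootForm ℤ).rootLength θ := by
  refine h.highest.rootLength_le (fun β hβ ↦ ?_) i
  by_cases hβα : β = α
  · rw [hβα, h.pairing_eq]; norm_num
  · rw [h.pairing_zero β hβ hβα]

/-- From ⟨θ, α⟩ = 1 the squared length of α is ⟨α, θ⟩ times that of θ; as θ is longest, the factor
must be 1. -/
lemma pairingIn_and_rootLength : P.pairingIn ℤ α θ = 1 ∧
    (P.posRootForm ℤ).rootLength α = (P.posRootForm ℤ).rootLength θ := by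
  have h1 := (P.posRootForm ℤ).pairingIn_mul_eq_pairingIn_mul_swap θ α
  rw [h.pairing_eq, one_mul] at h1
  have h2 : 0 < P.pairingIn ℤ α θ :=
    (P.zero_lt_pairingIn_iff' ℤ).mp (by rw [h.pairing_eq]; norm_num)
  have h3 := h.rootLength_le α
  have h4 := (P.posRootForm ℤ).rootLength_pos θ
  have h5 : P.pairingIn ℤ α θ = 1 := by
    by_contra hne
    have : 2 ≤ P.pairingIn ℤ α θ := by omega
    nlinarith
  rw [h5] at h1
  exact ⟨h5, by omega⟩

lemma pairingIn_highest : P.pairingIn ℤ α θ = 1 := h.pairingIn_and_rootLength.1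

lemma isLong : IsLong P α := fun i ↦ h.pairingIn_and_rootLength.2 ▸ h.rootLength_le i

lemma pairingIn_highest_of_ne {β : ι} (hβ : β ∈ b.support) (hne : β ≠ α) :
    P.pairingIn ℤ β θ = 0 :=
  pairingIn_eq_zero_comm.mp (h.pairing_zero β hβ hne)

lemma pairingIn_highest_nonneg {β : ι} (hβ : β ∈ b.support) : 0 ≤ P.pairingIn ℤ β θ := by
  by_cases hne : β = α
  · rw [hne, h.pairingIn_highest]; norm_num
  · rw [h.pairingIn_highest_of_ne hβ hne]

/-- Both sides are linear and agree on simple roots. With γ = θ this gives [θ : α] = 2. -/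
lemma coeff_eq (i : ι) : coeff b i ⟨α, h.mem⟩ = P.pairingIn ℤ i θ := by
  classical
  rw [(rootLinear_pairingIn θ).eq_sum_coeff b i, Finset.sum_eq_single ⟨α, h.mem⟩]
  · simp [h.pairingIn_highest]
  · intro β _ hβ
    rw [h.pairingIn_highest_of_ne β.2 (fun hh ↦ hβ (Subtype.ext hh)), mul_zero]
  · simp

end IsFundamentalHighest

variable [P.IsReduced]

lemma abs_pairingIn_le_one {i j : ι}
    (hlong : (P.posRootForm ℤ).rootLength i ≤ (P.posRootForm ℤ).rootLength j)
    (hne : i ≠ j) (hne' : P.root i ≠ -P.root j) : |P.pairingIn ℤ i j| ≤ 1 := by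
  by_contra hcon
  have := (P.posRootForm ℤ).rootLength_lt_of_pairingIn_notMem (i := i) (j := j)
    (fun hh ↦ hne (P.root.injective hh)) hne' (by
      intro hmem
      simp only [Set.mem_insert_iff, Set.mem_singleton_iff] at hmem
      rcases hmem with hm | hm | hm <;> simp [hm] at hcon)
  omega

namespace IsFundamentalHighest

variable (h : IsFundamentalHighest b θ α)

include h

lemma pairingIn_adjacent {β : ι} (hβ : β ∈ adjacent b α) : P.pairingIn ℤ β α = -1 := by
  obtain ⟨hβ, hne, hne0⟩ := hβ
  have h1 : P.pairingIn ℤ β α ≤ 0 := b.pairingIn_le_zero_of_ne hne hβ h.mem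
  have h2 := abs_le.mp (abs_pairingIn_le_one (h.isLong β) hne (b.root_ne_neg_of_ne hβ h.mem hne))
  have h3 : P.pairingIn ℤ β α ≠ 0 := by
    intro h0
    apply hne0
    rw [← P.algebraMap_pairingIn ℤ, h0, map_zero]
  omega

/-- Both sides are linear, so simple roots suffice: α gives 2 - 2 = 0, a root adjacent to α gives 0
+ 1 (its pairing with the long root α is -1), and any other simple root gives 0. -/
lemma deg_eq (i : ι) :
    deg b (adjacent b α) i = 2 * P.pairingIn ℤ i θ - P.pairingIn ℤ i α := by
  classical
  have hlin : RootLinear P fun i ↦ 2 * P.pairingIn ℤ i θ - P.pairingIn ℤ i α := by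
    convert ((rootLinear_pairingIn (P := P) θ).add (rootLinear_pairingIn θ)).add
      (rootLinear_pairingIn α).neg using 2
    simp only [Pi.add_apply, Pi.neg_apply]
    ring
  rw [hlin.eq_sum_coeff b i, deg]
  refine Finset.sum_congr rfl fun β _ ↦ ?_
  by_cases hβα : (β : ι) = α
  · have : (β : ι) ∉ adjacent b α := fun hh ↦ hh.2.1 hβα
    rw [if_neg this, hβα, h.pairingIn_highest, P.pairingIn_same]
    ring
  · rw [h.pairingIn_highest_of_ne β.2 hβα]
    by_cases hadj : (β : ι) ∈ adjacent b α
    · rw [if_pos hadj, h.pairingIn_adjacent hadj]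
      ring
    · rw [if_neg hadj]
      have : P.pairing β α = 0 := by
        by_contra hne
        exact hadj ⟨β.2, hβα, hne⟩
      have : P.pairingIn ℤ β α = 0 := by
        apply FaithfulSMul.algebraMap_injective ℤ K
        rw [P.algebraMap_pairingIn, this, map_zero]
      rw [this]
      ring

lemma pairingIn_nonneg {i : ι} (hi : b.IsPos i) : 0 ≤ P.pairingIn ℤ i θ :=
  (rootLinear_pairingIn θ).nonneg_of_isPos (fun _ hβ ↦ h.pairingIn_highest_nonneg hβ) hi

lemma isPos_of_pairingIn_pos {i : ι} (hi : 0 < P.pairingIn ℤ i θ) : b.IsPos i :=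
  (rootLinear_pairingIn θ).isPos_of_pos (fun _ hβ ↦ h.pairingIn_highest_nonneg hβ) hi

lemma deg_nonneg_of_mem {β : ι} (hβ : β ∈ b.support) : 0 ≤ deg b (adjacent b α) β := by
  rw [h.deg_eq]
  by_cases hne : β = α
  · rw [hne, h.pairingIn_highest, P.pairingIn_same]; norm_num
  · have := b.pairingIn_le_zero_of_ne hne hβ h.mem
    rw [h.pairingIn_highest_of_ne hβ hne]
    omega

lemma deg_nonneg {i : ι} (hi : b.IsPos i) : 0 ≤ deg b (adjacent b α) i :=
  (rootLinear_deg b _).nonneg_of_isPos (fun _ hβ ↦ h.deg_nonneg_of_mem hβ) hi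

lemma isPos_of_deg_pos {i : ι} (hi : 0 < deg b (adjacent b α) i) : b.IsPos i :=
  (rootLinear_deg b _).isPos_of_pos (fun _ hβ ↦ h.deg_nonneg_of_mem hβ) hi

/-- The possible values of the pairings of a positive root with `θ` and `α`. -/
lemma isPos_cases {i : ι} (hi : b.IsPos i) :
    (i = θ ∧ P.pairingIn ℤ i θ = 2 ∧ P.pairingIn ℤ i α = 1) ∨
    (i = α ∧ P.pairingIn ℤ i θ = 1 ∧ P.pairingIn ℤ i α = 2) ∨
    (i ≠ α ∧ P.pairingIn ℤ i θ = 1 ∧ -1 ≤ P.pairingIn ℤ i α ∧ P.pairingIn ℤ i α ≤ 1) ∨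
    (P.pairingIn ℤ i θ = 0 ∧ -1 ≤ P.pairingIn ℤ i α ∧ P.pairingIn ℤ i α ≤ 0) := by
  by_cases hiθ : i = θ
  · left; rw [hiθ]; exact ⟨rfl, P.pairingIn_same ℤ θ, h.pairing_eq⟩
  by_cases hiα : i = α
  · right; left; rw [hiα]; exact ⟨rfl, h.pairingIn_highest, P.pairingIn_same ℤ α⟩
  right; right
  have h1 := abs_le.mp (abs_pairingIn_le_one (h.rootLength_le i) hiθ fun hh ↦
    (isPos_neg_iff hh).mp hi h.highest.isPos)
  have h2 := abs_le.mp (abs_pairingIn_le_one (h.isLong i) hiα fun hh ↦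
    (isPos_neg_iff hh).mp hi (b.isPos_of_mem_support h.mem))
  have h3 := h.pairingIn_nonneg hi
  -- When the pairing with θ is 0, nonnegativity of the degree excludes pairing 1 with α.
  have h4 := h.deg_nonneg hi
  rw [h.deg_eq] at h4
  have : P.pairingIn ℤ i θ = 0 ∨ P.pairingIn ℤ i θ = 1 := by omega
  rcases this with h0 | h0
  · right; omega
  · left; exact ⟨hiα, h0, h2⟩

lemma exists_root_sub {i : ι} (hi : P.pairingIn ℤ i θ = 1) :
    ∃ j, P.root j = P.root θ - P.root i ∧ P.pairingIn ℤ j θ = 1 ∧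
      P.pairingIn ℤ j α = 1 - P.pairingIn ℤ i α := by
  have h1 : 0 < P.pairingIn ℤ θ i := (P.zero_lt_pairingIn_iff' ℤ).mp (by omega)
  obtain ⟨j, hj⟩ := P.root_sub_root_mem_of_pairingIn_pos h1 (by
    rintro rfl; rw [P.pairingIn_same] at hi; omega)
  have h2 := (rootLinear_pairingIn θ).eq_sub hj
  have h3 := (rootLinear_pairingIn α).eq_sub hj
  simp only [P.pairingIn_same, h.pairing_eq] at h2 h3
  exact ⟨j, hj, by omega, h3⟩

lemma deg_le_three (i : ι) : deg b (adjacent b α) i ≤ 3 := by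
  rcases em (b.IsPos i) with hi | hi
  · rw [h.deg_eq]
    rcases h.isPos_cases hi with hh | hh | hh | hh <;> omega
  · have := h.deg_nonneg (isPos_reflectionPerm_self_iff.mpr hi)
    rw [(rootLinear_deg b _).reflectionPerm_self] at this
    omega

/-- By irreducibility it suffices that a root j outside the span is orthogonal to every root i with
⟨i, θ⟩ ≠ 0. Such a j is orthogonal to θ, so reflecting i in j keeps its pairing with θ; if i and j
were not orthogonal, j would be a multiple of the difference of i and its reflection, hence in the
span. -/
lemma span_not_orthogonal [P.IsIrreducible] :
    Submodule.span K (P.root '' {i | P.pairingIn ℤ i θ ≠ 0}) = ⊤ := by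
  have : Module.IsReflexive K M := .of_isPerfPair P.toLinearMap
  refine P.span_root_image_eq_top_of_forall_orthogonal _ ⟨θ, by simp⟩ fun j hj i hi ↦ ?_
  rw [P.isOrthogonal_iff_pairing_eq_zero]
  by_contra hji
  replace hji : P.pairing i j ≠ 0 := fun h0 ↦ hji (P.pairing_eq_zero_iff.mp h0)
  have hj0 : P.pairingIn ℤ j θ = 0 := by
    by_contra hne
    exact hj (Submodule.subset_span ⟨j, hne, rfl⟩)
  have hi' : P.pairingIn ℤ (P.reflectionPerm j i) θ ≠ 0 := by
    rw [(rootLinear_pairingIn θ).reflectionPerm, hj0, mul_zero, sub_zero]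
    exact hi
  apply hj
  have heq : P.root j = (P.pairing i j)⁻¹ • (P.root i - P.root (P.reflectionPerm j i)) := by
    rw [P.root_reflectionPerm, P.reflection_apply_root, sub_sub_cancel, smul_smul,
      inv_mul_cancel₀ hji, one_smul]
  rw [heq]
  exact Submodule.smul_mem _ _ (Submodule.sub_mem _ (Submodule.subset_span ⟨i, hi, rfl⟩)
    (Submodule.subset_span ⟨_, hi', rfl⟩))

/-- Some root j is orthogonal to neither θ nor i, because the roots not orthogonal to θ span. Up to
sign ⟨j, θ⟩ > 0, and then j or θ - j pairs to 1 with both θ and α. Reflecting in i, which is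
orthogonal to θ and α, fixes the sign of the pairing with i. -/
lemma exists_pairingIn_neg [P.IsIrreducible] {i : ι} (hiθ : P.pairingIn ℤ i θ = 0)
    (hiα : P.pairingIn ℤ i α = 0) :
    ∃ j, P.pairingIn ℤ j θ = 1 ∧ P.pairingIn ℤ j α = 1 ∧ P.pairingIn ℤ j i < 0 := by
  obtain ⟨j, hj, hji⟩ : ∃ j, P.pairingIn ℤ j θ ≠ 0 ∧ P.pairingIn ℤ j i ≠ 0 := by
    by_contra! hcon
    have hle : Submodule.span K (P.root '' {i | P.pairingIn ℤ i θ ≠ 0}) ≤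
        LinearMap.ker (P.coroot' i) := by
      rw [Submodule.span_le]
      rintro _ ⟨j, hj, rfl⟩
      have := hcon j hj
      simp only [SetLike.mem_coe, LinearMap.mem_ker, P.root_coroot'_eq_pairing]
      rw [← P.algebraMap_pairingIn ℤ, this, map_zero]
    rw [h.span_not_orthogonal] at hle
    have := hle (Submodule.mem_top (x := P.root i))
    simp at this
  obtain ⟨j, hj, hji⟩ : ∃ j, 0 < P.pairingIn ℤ j θ ∧ P.pairingIn ℤ j i ≠ 0 := by
    rcases lt_or_gt_of_ne hj with hj | hj
    · exact ⟨P.reflectionPerm j j, by simpa using hj, by simpa using hji⟩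
    · exact ⟨j, hj, hji⟩
  have key (k : ι) (hk : P.pairingIn ℤ k θ = 1) (hk' : P.pairingIn ℤ k α = 1)
      (hki : P.pairingIn ℤ k i ≠ 0) :
      ∃ j, P.pairingIn ℤ j θ = 1 ∧ P.pairingIn ℤ j α = 1 ∧ P.pairingIn ℤ j i < 0 := by
    rcases lt_or_gt_of_ne hki with hki | hki
    · exact ⟨k, hk, hk', hki⟩
    · refine ⟨P.reflectionPerm i k, ?_, ?_, ?_⟩ <;>
        rw [(rootLinear_pairingIn _).reflectionPerm]
      · simp [hiθ, hk]
      · simp [hiα, hk']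
      · rw [P.pairingIn_same]; omega
  have hθi := pairingIn_eq_zero_comm.mp hiθ
  have hαi := pairingIn_eq_zero_comm.mp hiα
  rcases h.isPos_cases (h.isPos_of_pairingIn_pos hj) with hh | hh | hh | hh
  · exact absurd hθi (hh.1 ▸ hji)
  · exact absurd hαi (hh.1 ▸ hji)
  · obtain ⟨k, hk, hkθ, hkα⟩ := h.exists_root_sub hh.2.1
    have hki := (rootLinear_pairingIn i).eq_sub hk
    simp only [hθi] at hki
    have hkpos := h.isPos_of_pairingIn_pos (i := k) (by omega)
    rcases h.isPos_cases hkpos with h' | h' | h' | h'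
    · omega
    -- Here θ - j would be α itself, which is orthogonal to i, whereas ⟨θ - j, i⟩ = -⟨j, i⟩ ≠ 0.
    · exact absurd hαi (h'.1 ▸ (by omega))
    · by_cases h1 : P.pairingIn ℤ j α = 1
      · exact key j hh.2.1 h1 hji
      · exact key k hkθ (by omega) (by omega)
    · omega
  · omega

lemma exists_root_add {i j : ι} (hi : b.IsPos i) (hj : b.IsPos j) (hij : P.pairingIn ℤ i j < 0) :
    ∃ k, P.root k = P.root i + P.root j :=
  P.root_add_root_mem_of_pairingIn_neg hij fun hh ↦ (isPos_neg_iff hh).mp hi hj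

/-- Every positive root of degree at most one is either not orthogonal to `θ`, or can be raised to
a root of degree one that is not orthogonal to `θ`. -/
lemma exists_raise [P.IsIrreducible] {i : ι} (hi : b.IsPos i) (hd : deg b (adjacent b α) i ≤ 1) :
    P.pairingIn ℤ i θ = 1 ∨ ∃ j k, b.IsPos j ∧ P.root k = P.root j + P.root i ∧
      P.pairingIn ℤ k θ = 1 ∧ deg b (adjacent b α) k = 1 := by
  rw [h.deg_eq] at hd
  rcases h.isPos_cases hi with hh | hh | hh | hh
  · omega
  · exact .inl hh.2.1
  · exact .inl hh.2.1
  · right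
    -- The raised root has pairings (1, 1) with θ and α, hence degree 2 - 1 = 1. The summand is α
    -- when ⟨i, α⟩ = -1, and comes from `exists_pairingIn_neg` when i is orthogonal to both.
    have fin (j : ι) (hj : b.IsPos j) (hji : P.pairingIn ℤ j i < 0) (hjθ : P.pairingIn ℤ j θ = 1)
        (hjα : P.pairingIn ℤ j α + P.pairingIn ℤ i α = 1) :
        ∃ j k, b.IsPos j ∧ P.root k = P.root j + P.root i ∧
          P.pairingIn ℤ k θ = 1 ∧ deg b (adjacent b α) k = 1 := by
      obtain ⟨k, hk⟩ := h.exists_root_add hj hi hji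
      have h1 := (rootLinear_pairingIn θ).eq_add hk
      have h2 := (rootLinear_pairingIn α).eq_add hk
      exact ⟨j, k, hj, hk, by omega, by rw [h.deg_eq]; omega⟩
    by_cases hq : P.pairingIn ℤ i α = 0
    · obtain ⟨j, h1, h2, h3⟩ := h.exists_pairingIn_neg hh.1 hq
      exact fin j (h.isPos_of_pairingIn_pos (by omega)) h3 h1 (by omega)
    · refine fin α (b.isPos_of_mem_support h.mem) ?_ h.pairingIn_highest ?_
      · exact (P.pairingIn_lt_zero_iff ℤ).mp (by omega)
      · rw [P.pairingIn_same]; omega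

lemma deg_adjacent {β : ι} (hβ : β ∈ adjacent b α) : deg b (adjacent b α) β = 1 := by
  rw [h.deg_eq, h.pairingIn_highest_of_ne hβ.1 hβ.2.1, h.pairingIn_adjacent hβ]
  norm_num

/-- Each simple root adjacent to `α` lowers some root of degree two. -/
lemma exists_root_sub_adjacent {β : ι} (hβ : β ∈ adjacent b α) :
    ∃ i j, P.root j = P.root i - P.root β ∧ deg b (adjacent b α) i = 2 := by
  classical
  have hαpos := b.isPos_of_mem_support h.mem
  have hadd (β : ι) (hβ : β ∈ adjacent b α) : ∃ k, P.root k = P.root β + P.root α :=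
    h.exists_root_add (b.isPos_of_mem_support hβ.1) hαpos (by rw [h.pairingIn_adjacent hβ]; norm_num)
  have hdeg (β k : ι) (hβ : β ∈ adjacent b α) (hk : P.root k = P.root β + P.root α) :
      P.pairingIn ℤ k θ = 1 ∧ P.pairingIn ℤ k α = 1 := by
    have h1 := (rootLinear_pairingIn θ).eq_add hk
    have h2 := (rootLinear_pairingIn α).eq_add hk
    simp only [h.pairingIn_highest, h.pairingIn_highest_of_ne hβ.1 hβ.2.1, P.pairingIn_same,
      h.pairingIn_adjacent hβ] at h1 h2
    omega
  obtain ⟨k, hk⟩ := hadd β hβ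
  obtain ⟨hkθ, hkα⟩ := hdeg β k hβ hk
  by_cases hex : ∃ β' ∈ adjacent b α, β' ≠ β
  -- With a second neighbour β' of α, the root β + α + β' has degree 2 and subtracting β leaves the
  -- root α + β'.
  · obtain ⟨β', hβ', hne⟩ := hex
    have h1 : P.pairingIn ℤ k β' < 0 := by
      have h1 := (rootLinear_pairingIn β').eq_add hk
      have h2 := b.pairingIn_le_zero_of_ne hne.symm hβ.1 hβ'.1
      have h3 : P.pairingIn ℤ α β' < 0 :=
        (P.pairingIn_lt_zero_iff ℤ).mp (by rw [h.pairingIn_adjacent hβ']; norm_num)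
      omega
    obtain ⟨i, hi⟩ := h.exists_root_add (h.isPos_of_pairingIn_pos (by omega))
      (b.isPos_of_mem_support hβ'.1) h1
    obtain ⟨j, hj⟩ := hadd β' hβ'
    refine ⟨i, j, by rw [hi, hj, hk]; abel, ?_⟩
    rw [(rootLinear_deg b _).eq_add hi, h.deg_adjacent hβ', h.deg_eq, hkθ, hkα]
    norm_num
  · push Not at hex
    -- If β is the only neighbour, take a root of minimal height with pairings (1, 0), hence of
    -- degree 2; θ - (α + β) shows that there is one. A simple root pairing positively with it can
    -- be subtracted. That simple root is not α, and a simple root other than α and β would leave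
    -- the pairings unchanged and contradict minimality.
    obtain ⟨m, hm, hmθ, hmα⟩ := h.exists_root_sub hkθ
    obtain ⟨i, hi, hmin⟩ := Finset.exists_min_image
      (Finset.univ.filter fun i ↦ P.pairingIn ℤ i θ = 1 ∧ P.pairingIn ℤ i α = 0)
      b.height ⟨m, by simp [hmθ, hmα, hkα]⟩
    simp only [Finset.mem_filter, Finset.mem_univ, true_and] at hi hmin
    have hipos := h.isPos_of_pairingIn_pos (i := i) (by omega)
    obtain ⟨κ, hκ, hκi⟩ := hipos.exists_mem_support_pos_pairingIn
    have hiκ : 0 < P.pairingIn ℤ i κ := (P.zero_lt_pairingIn_iff' ℤ).mp hκi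
    have hκα : κ ≠ α := by rintro rfl; omega
    obtain ⟨j, hj⟩ := P.root_sub_root_mem_of_pairingIn_pos hiκ (by
      rintro rfl
      have := h.pairingIn_highest_of_ne hκ hκα
      omega)
    by_cases hadj : κ ∈ adjacent b α
    · rw [hex κ hadj] at hj
      exact ⟨i, j, hj, by rw [h.deg_eq]; omega⟩
    · exfalso
      have h0 : P.pairingIn ℤ κ α = 0 := by
        have := h.deg_eq κ
        by_contra hne
        refine hadj ⟨hκ, hκα, fun h0 ↦ hne ?_⟩
        apply FaithfulSMul.algebraMap_injective ℤ K
        rw [P.algebraMap_pairingIn, h0, map_zero]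
      have h1 := (rootLinear_pairingIn θ).eq_sub hj
      have h2 := (rootLinear_pairingIn α).eq_sub hj
      have h3 := b.height_sub hj
      rw [RootPairing.Base.height_one_of_mem_support hκ] at h3
      simp only [h.pairingIn_highest_of_ne hκ hκα, h0] at h1 h2
      have := hmin j ⟨by omega, by omega⟩
      omega

end IsFundamentalHighest

end HighestRoot

/-! ### The affine Weyl group acting on affine roots by a permutation and a translation. -/

section AffineAction

variable {ι K M N : Type*} [Fintype ι] [Field K] [CharZero K] [AddCommGroup M] [Module K M]
  [AddCommGroup N] [Module K N] {P : RootPairing ι K M N} [P.IsCrystallographic]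
  {b : P.Base} {θ α : ι}

lemma formHat_apply (x y : VHat K M) :
    formHat P x y = P.RootForm x.1 y.1 + x.2.1 * y.2.2 + x.2.2 * y.2.1 := by
  simp [formHat]

variable (P) in
/-- `w` acts on the affine roots by the permutation `e` of the roots and the translation `n`. -/
structure AffineAction (w : VHat K M ≃ₗ[K] VHat K M) (e : Equiv.Perm ι) (n : ι → ℤ) : Prop where
  apply_root (i : ι) (r : K) : w (P.root i, r, 0) = (P.root (e i), r + n i, 0)
  pairing_eq (i j : ι) : P.pairingIn ℤ (e i) (e j) = P.pairingIn ℤ i j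
  mem : n ∈ corootLattice P

lemma pairingIn_reflectionPerm_reflectionPerm (i j k : ι) :
    P.pairingIn ℤ (P.reflectionPerm k i) (P.reflectionPerm k j) = P.pairingIn ℤ i j := by
  rw [← P.pairingIn_reflectionPerm ℤ, P.reflectionPerm_self]

/-- Identifies the reflection defined by the invariant form with the one defined by the coroot, so
that `reflHat` can be computed inside the root pairing. -/
lemma rootForm_div_smul (β : ι) (x : M) :
    (P.RootForm (P.root β) x) * (2 / P.RootForm (P.root β) (P.root β)) = P.coroot' β x := by
  have hne : P.RootForm (P.root β) (P.root β) ≠ 0 := (P.posRootForm ℤ).form_apply_root_ne_zero β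
  have h := congrArg (P.toLinearMap x) (P.rootForm_self_smul_coroot β)
  have h2 : P.toLinearMap x (P.Polarization (P.root β)) = P.RootForm (P.root β) x := by
    rw [P.rootForm_apply_apply, P.Polarization_apply, map_sum]
    simp only [map_smul, smul_eq_mul]
    rfl
  rw [map_smul, map_nsmul, h2, smul_eq_mul, nsmul_eq_mul] at h
  have h3 : P.toLinearMap x (P.coroot β) = P.coroot' β x := rfl
  rw [h3] at h
  field_simp
  push_cast at h
  linear_combination -h

lemma AffineAction.of_reflHat_rootHat {w : VHat K M ≃ₗ[K] VHat K M} {β : ι}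
    (hw : (w : VHat K M →ₗ[K] VHat K M) = reflHat P (rootHat P β)) :
    AffineAction P w (P.reflectionPerm β) 0 where
  apply_root i r := by
    rw [← LinearEquiv.coe_coe, hw, reflHat, Module.preReflection_apply, smul_smul,
      formHat_apply, formHat_apply]
    simp only [rootHat, mul_zero, zero_mul, add_zero, rootForm_div_smul, P.root_reflectionPerm,
      P.reflection_apply_root, P.root_coroot'_eq_pairing, Prod.smul_mk, smul_zero,
      Prod.mk_sub_mk, sub_zero, Pi.zero_apply, Int.cast_zero]
  pairing_eq i j := pairingIn_reflectionPerm_reflectionPerm i j β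
  mem := zero_mem _

/-- The vector δ is isotropic and orthogonal to the roots, so δ - θ pairs with γ + rδ as -θ does
with γ; subtracting that multiple of δ - θ reflects γ in θ and shifts r by ⟨γ, θ⟩. -/
lemma AffineAction.of_reflHat_alphaZero {w : VHat K M ≃ₗ[K] VHat K M}
    (hw : (w : VHat K M →ₗ[K] VHat K M) = reflHat P (alphaZero P θ)) :
    AffineAction P w (P.reflectionPerm θ) (fun i ↦ P.pairingIn ℤ i θ) where
  apply_root i r := by
    have h1 : alphaZero P θ = (-P.root θ, 1, 0) := by simp [alphaZero, delta, rootHat]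
    have h2 := rootForm_div_smul (P := P) θ (P.root i)
    rw [← LinearEquiv.coe_coe, hw, reflHat, Module.preReflection_apply, smul_smul,
      formHat_apply, formHat_apply, h1]
    simp only [mul_zero, zero_mul, add_zero, map_neg, LinearMap.neg_apply, neg_neg, neg_mul, h2,
      P.root_reflectionPerm, P.reflection_apply_root, P.root_coroot'_eq_pairing, Prod.smul_mk,
      smul_zero, Prod.mk_sub_mk, sub_zero, ← P.algebraMap_pairingIn ℤ]
    simp
  pairing_eq i j := pairingIn_reflectionPerm_reflectionPerm i j θ
  mem := pairingIn_mem_corootLattice θ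

lemma AffineAction.one : AffineAction P 1 1 0 where
  apply_root i r := by simp
  pairing_eq i j := rfl
  mem := zero_mem _

lemma AffineAction.mul {w w' : VHat K M ≃ₗ[K] VHat K M} {e e' : Equiv.Perm ι} {n n' : ι → ℤ}
    (h : AffineAction P w e n) (h' : AffineAction P w' e' n') :
    AffineAction P (w * w') (e * e') (n' + n ∘ e') where
  apply_root i r := by
    rw [LinearEquiv.mul_apply, h'.apply_root, h.apply_root]
    simp [add_assoc]
  pairing_eq i j := by simp [h.pairing_eq, h'.pairing_eq]
  mem := add_mem h'.mem (comp_mem_corootLattice h.mem h'.pairing_eq)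

lemma AffineAction.inv {w : VHat K M ≃ₗ[K] VHat K M} {e : Equiv.Perm ι} {n : ι → ℤ}
    (h : AffineAction P w e n) : AffineAction P w⁻¹ e⁻¹ (-(n ∘ ⇑e⁻¹)) where
  apply_root i r := by
    have := h.apply_root (e⁻¹ i) (r - n (e⁻¹ i))
    rw [show e (e⁻¹ i) = i from e.apply_symm_apply i, sub_add_cancel] at this
    rw [← this, ← LinearEquiv.mul_apply, inv_mul_cancel]
    simp [sub_eq_add_neg]
  pairing_eq i j := by rw [← h.pairing_eq]; simp
  mem := neg_mem (comp_mem_corootLattice h.mem fun i j ↦ by rw [← h.pairing_eq]; simp)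

lemma exists_affineAction {w : VHat K M ≃ₗ[K] VHat K M} (hw : w ∈ affineWeylGroup b θ) :
    ∃ e n, AffineAction P w e n := by
  induction hw using Subgroup.closure_induction with
  | mem w hw =>
    obtain ⟨β, hβ, hw⟩ := hw
    rcases hβ with rfl | ⟨β, -, rfl⟩
    · exact ⟨_, _, .of_reflHat_alphaZero hw⟩
    · exact ⟨_, _, .of_reflHat_rootHat hw⟩
  | one => exact ⟨_, _, .one⟩
  | mul w w' _ _ hw hw' =>
    obtain ⟨e, n, h⟩ := hw
    obtain ⟨e', n', h'⟩ := hw'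
    exact ⟨_, _, h.mul h'⟩
  | inv w _ hw =>
    obtain ⟨e, n, h⟩ := hw
    exact ⟨_, _, h.inv⟩

section Action

variable {w : VHat K M ≃ₗ[K] VHat K M} {e : Equiv.Perm ι} {n : ι → ℤ}

lemma AffineAction.root_eq_sum (h : AffineAction P w e n) {κ : Type*} {s : Finset κ} {a : κ → ℤ}
    {f : κ → ι} {k : ι} (hk : P.root k = ∑ j ∈ s, a j • P.root (f j)) :
    P.root (e k) = ∑ j ∈ s, a j • P.root (e (f j)) := by
  let φ : M →ₗ[K] M := (LinearMap.fst K M (K × K)).comp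
    ((w : VHat K M →ₗ[K] VHat K M).comp (LinearMap.inl K M (K × K)))
  have hφ (i : ι) : φ (P.root i) = P.root (e i) := by
    have := h.apply_root i 0
    simp [φ, ← Prod.mk_zero_zero, this]
  rw [← hφ, hk, map_sum]
  simp [hφ]

lemma AffineAction.root_neg (h : AffineAction P w e n) {i k : ι} (hk : P.root k = -P.root i) :
    P.root (e k) = -P.root (e i) := by
  have := h.root_eq_sum (s := Finset.univ) (a := fun _ : Unit ↦ -1) (f := fun _ ↦ i) (k := k)
    (by simp [hk])
  simpa using this

lemma RootLinear.comp {F : ι → ℤ} (hF : RootLinear P F) (h : AffineAction P w e n) (b : P.Base) :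
    RootLinear P (F ∘ e) := by
  have : F ∘ e = fun i ↦ ∑ j : b.support, coeff b i j * F (e j) := by
    ext i
    exact hF.eq_sum (h.root_eq_sum (root_eq_sum_coeff b i))
  rw [this]
  refine .sum fun j ↦ ?_
  obtain ⟨φ, hφ⟩ := rootLinear_coeff b j
  exact ⟨F (e j) • φ, fun i ↦ by simp [hφ, mul_comm]⟩

lemma mem_posHat_iff {i : ι} {m : ℤ} :
    (P.root i, (m : K), (0 : K)) ∈ posHat b ↔ 1 ≤ m ∨ m = 0 ∧ b.IsPos i := by
  constructor
  · rintro (⟨j, hj, heq⟩ | ⟨j, k, hk, heq⟩)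
    · simp only [rootHat, Prod.mk.injEq, Int.cast_eq_zero, and_true] at heq
      exact .inr ⟨heq.2, P.root.injective heq.1 ▸ hj⟩
    · left
      simp only [rootHat, delta, Prod.smul_mk, smul_zero, Prod.mk_add_mk, add_zero,
        zero_add, nsmul_eq_mul, mul_one, Prod.mk.injEq, and_true] at heq
      have : m = k := by exact_mod_cast heq.2
      omega
  · rintro (hm | ⟨rfl, hi⟩)
    · obtain ⟨k, rfl⟩ := Int.eq_ofNat_of_zero_le (show 0 ≤ m by omega)
      exact .inr ⟨i, k, by omega, by simp [rootHat, delta]⟩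
    · exact .inl ⟨i, hi, by simp [rootHat]⟩

lemma exists_of_mem_posHat {x : VHat K M} (hx : x ∈ posHat b) :
    ∃ (i : ι) (m : ℤ), x = (P.root i, (m : K), (0 : K)) := by
  rcases hx with ⟨j, hj, rfl⟩ | ⟨j, k, hk, rfl⟩
  · exact ⟨j, 0, by simp [rootHat]⟩
  · exact ⟨j, k, by simp [rootHat, delta]⟩

lemma root_reflectionPerm_self (i : ι) : P.root (P.reflectionPerm i i) = -P.root i := by
  rw [P.root_reflectionPerm, P.reflection_apply_self]

lemma AffineAction.mem_inversionSet_iff (h : AffineAction P w e n) {i : ι} {m : ℤ} :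
    (P.root i, (m : K), (0 : K)) ∈ inversionSet b w ↔ (1 ≤ m ∨ m = 0 ∧ b.IsPos i) ∧
      (m + n i ≤ -1 ∨ m + n i = 0 ∧ ¬ b.IsPos (e i)) := by
  rw [inversionSet, Set.mem_ofPred_eq, mem_posHat_iff, h.apply_root]
  have : -(P.root (e i), (m : K) + n i, (0 : K)) =
      (P.root (P.reflectionPerm (e i) (e i)), ((-(m + n i) : ℤ) : K), (0 : K)) := by
    simp
  rw [this, mem_posHat_iff, isPos_reflectionPerm_self_iff]
  refine and_congr_right fun _ ↦ or_congr ?_ (and_congr_left fun _ ↦ ?_) <;> omega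

lemma mem_delta_sub_iff {I : Set ι} {i : ι} {m : ℤ} :
    (P.root i, (m : K), (0 : K)) ∈ {x | ∃ γ ∈ I, x = delta K M - rootHat P γ} ↔
      m = 1 ∧ P.reflectionPerm i i ∈ I := by
  constructor
  · rintro ⟨γ, hγ, heq⟩
    simp only [rootHat, delta, Prod.mk_sub_mk, zero_sub, sub_zero, Prod.mk.injEq,
      and_true] at heq
    refine ⟨by exact_mod_cast heq.2, ?_⟩
    have : P.reflectionPerm i i = γ := P.root.injective (by
      rw [root_reflectionPerm_self, heq.1, neg_neg])
    rwa [this]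
  · rintro ⟨rfl, hi⟩
    exact ⟨_, hi, by simp [rootHat, delta]⟩

/-- A criterion for an element of the affine Weyl group to be minuscule. -/
lemma AffineAction.inversionSet_eq_iff (h : AffineAction P w e n) {I : Set ι} :
    inversionSet b w = {x | ∃ γ ∈ I, x = delta K M - rootHat P γ} ↔
      (∀ i, b.IsPos i → 1 ≤ n i ∨ n i = 0 ∧ b.IsPos (e i)) ∧
      (∀ i, b.IsPos i → n i ≤ 1 ∨ n i = 2 ∧ ¬ b.IsPos (e i)) ∧
      ∀ i, i ∈ I ↔ 2 ≤ n i ∨ n i = 1 ∧ b.IsPos (e i) := by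
  have hn := rootLinear_of_mem_corootLattice h.mem
  have hneg (i : ι) : b.IsPos (e (P.reflectionPerm i i)) ↔ ¬ b.IsPos (e i) :=
    isPos_neg_iff (h.root_neg (root_reflectionPerm_self i))
  have hnn (i : ι) : P.reflectionPerm (P.reflectionPerm i i) (P.reflectionPerm i i) = i :=
    P.root.injective (by rw [root_reflectionPerm_self, root_reflectionPerm_self, neg_neg])
  constructor
  · intro heq
    -- The three conditions come from three levels: γ itself and 2δ - γ are never inverted for
    -- positive γ, and δ - γ is inverted exactly when γ is in I. Conversely, they settle all other
    -- levels.
    have key (i : ι) (m : ℤ) := (h.mem_inversionSet_iff (b := b) (i := i) (m := m)).symm.trans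
      ((Set.ext_iff.mp heq _).trans mem_delta_sub_iff)
    refine ⟨fun i hi ↦ ?_, fun i hi ↦ ?_, fun i ↦ ?_⟩
    · have := key i 0
      simp only [hi, and_true, or_true, true_and] at this
      grind
    · have := key (P.reflectionPerm i i) 2
      rw [hneg, hn.reflectionPerm_self] at this
      grind
    · have := key (P.reflectionPerm i i) 1
      rw [hneg, hn.reflectionPerm_self, hnn] at this
      grind
  · rintro ⟨hA, hB, hC⟩
    ext x
    by_cases hx : ∃ (i : ι) (m : ℤ), x = (P.root i, (m : K), (0 : K))
    · obtain ⟨i, m, rfl⟩ := hx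
      rw [h.mem_inversionSet_iff, mem_delta_sub_iff, hC, hn.reflectionPerm_self, hneg]
      by_cases hi : b.IsPos i
      · have h1 := hA i hi
        have h2 := hB i hi
        grind
      · have h1 := hA _ (isPos_reflectionPerm_self_iff.mpr hi)
        have h2 := hB _ (isPos_reflectionPerm_self_iff.mpr hi)
        rw [hneg, hn.reflectionPerm_self] at h1 h2
        grind
    · refine iff_of_false (fun hx' ↦ hx (exists_of_mem_posHat hx'.1)) ?_
      rintro ⟨γ, -, rfl⟩
      exact hx ⟨P.reflectionPerm γ γ, 1, by simp [rootHat, delta]⟩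

lemma AffineAction.apply_alphaZero_iff (h : AffineAction P w e n) :
    w (alphaZero P θ) + delta K M = rootHat P α ↔ P.root (e θ) = -P.root α ∧ n θ = 2 := by
  have h1 : alphaZero P θ = (P.root (P.reflectionPerm θ θ), 1, 0) := by
    simp [alphaZero, delta, rootHat]
  rw [h1, h.apply_root, h.root_neg (i := θ) (by simp),
    (rootLinear_of_mem_corootLattice h.mem).reflectionPerm_self]
  simp only [delta, rootHat, Prod.mk_add_mk, add_zero, Prod.mk.injEq, and_true]
  refine and_congr (by rw [neg_eq_iff_eq_neg]) ?_
  constructor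
  · intro heq
    have : (1 + -n θ + 1 : ℤ) = 0 := by exact_mod_cast heq
    omega
  · intro heq
    rw [heq]; push_cast; ring

end Action

end AffineAction

/-! ### Uniqueness: rootlet α determines the set of roots. -/

section Minuscule

variable {ι K M N : Type*} [Fintype ι] [Field K] [CharZero K] [AddCommGroup M] [Module K M]
  [AddCommGroup N] [Module K N] {P : RootPairing ι K M N} [P.IsCrystallographic] [P.IsReduced]
  {b : P.Base} {θ α : ι} {w : VHat K M ≃ₗ[K] VHat K M} {e : Equiv.Perm ι} {n : ι → ℤ}

lemma AffineAction.pairingIn_of_root_eq_neg (hw : AffineAction P w e n) {i j k : ι}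
    (hj : P.root (e j) = -P.root k) : P.pairingIn ℤ (e i) k = -P.pairingIn ℤ i j := by
  have : e j = P.reflectionPerm k k := P.root.injective (by rw [root_reflectionPerm_self, hj])
  rw [← hw.pairing_eq i j, this, P.pairingIn_reflectionPerm_self_right, neg_neg]

namespace IsFundamentalHighest

variable (h : IsFundamentalHighest b θ α)

include h

/-- The translation part of a minuscule element with rootlet `α` is determined. -/
lemma translation_eq [P.IsIrreducible] (hw : AffineAction P w e n)
    (hA : ∀ i, b.IsPos i → 1 ≤ n i ∨ n i = 0 ∧ b.IsPos (e i))
    (hB : ∀ i, b.IsPos i → n i ≤ 1 ∨ n i = 2 ∧ ¬ b.IsPos (e i))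
    (hθ : P.root (e θ) = -P.root α) (hnθ : n θ = 2) (i : ι) :
    n i = P.pairingIn ℤ i θ := by
  have hn := rootLinear_of_mem_corootLattice hw.mem
  have hce (i : ι) : P.pairingIn ℤ (e.symm i) θ = -P.pairingIn ℤ i α := by
    have := hw.pairingIn_of_root_eq_neg (i := e.symm i) hθ
    rw [e.apply_symm_apply] at this
    omega
  -- Since e carries θ to -α, the value of u at e(k) is n(k) - ⟨k, θ⟩, so the claim is u = 0. The
  -- minuscule bounds on n will give |u| ≤ 1.
  set u : ι → ℤ := (n ∘ e.symm) + fun i ↦ P.pairingIn ℤ i α with hu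
  have hui (i : ι) : u i = n (e.symm i) + P.pairingIn ℤ i α := rfl
  have hmem : u ∈ corootLattice P := by
    refine add_mem (comp_mem_corootLattice hw.mem fun i j ↦ ?_) (pairingIn_mem_corootLattice α)
    rw [← hw.pairing_eq, e.apply_symm_apply, e.apply_symm_apply]
  have hlin := rootLinear_of_mem_corootLattice hmem
  have hpos (i : ι) (hi : b.IsPos i) (hs : b.IsPos (e.symm i)) :
      0 ≤ n (e.symm i) ∧ n (e.symm i) ≤ 1 := by
    have h1 := hA _ hs
    have h2 := hB _ hs
    rw [e.apply_symm_apply] at h1 h2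
    exact ⟨by omega, by tauto⟩
  have hneg (i : ι) (hi : b.IsPos i) (hs : ¬ b.IsPos (e.symm i)) :
      -2 ≤ n (e.symm i) ∧ n (e.symm i) ≤ -1 := by
    have h1 := hA _ (isPos_reflectionPerm_self_iff.mpr hs)
    have h2 := hB _ (isPos_reflectionPerm_self_iff.mpr hs)
    have h3 := hw.root_neg (root_reflectionPerm_self (e.symm i))
    rw [e.apply_symm_apply] at h3
    rw [isPos_neg_iff h3] at h1 h2
    rw [hn.reflectionPerm_self] at h1 h2
    exact ⟨by omega, by rcases h1 with h1 | h1 <;> [omega; exact absurd hi h1.2]⟩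
  have hs_neg (i : ι) (hq : 0 < P.pairingIn ℤ i α) : ¬ b.IsPos (e.symm i) := fun hs ↦ by
    have := h.pairingIn_nonneg hs
    rw [hce] at this
    omega
  have hu1 (i : ι) (hi : b.IsPos i) (hq : P.pairingIn ℤ i α = 1) : -1 ≤ u i ∧ u i ≤ 0 := by
    have := hneg i hi (hs_neg i (by omega))
    rw [hui]; omega
  have hu2 (i : ι) (hi : b.IsPos i) (hq : P.pairingIn ℤ i α = -1) : -1 ≤ u i ∧ u i ≤ 0 := by
    have := hpos i hi (h.isPos_of_pairingIn_pos (by rw [hce]; omega))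
    rw [hui]; omega
  have huα : u α = 0 := by
    have hroot : P.root (e.symm α) = -P.root θ := by
      have h1 := hw.root_neg (root_reflectionPerm_self θ)
      rw [hθ, neg_neg] at h1
      rw [← P.root.injective h1, e.symm_apply_apply, root_reflectionPerm_self]
    rw [hui, hn.eq_neg hroot, hnθ, P.pairingIn_same]
    norm_num
  have huθ := hu1 θ h.highest.isPos h.pairing_eq
  have habs_pos (i : ι) (hi : b.IsPos i) : |u i| ≤ 1 := by
    rw [abs_le]
    rcases eq_or_ne (P.pairingIn ℤ i α) 0 with hq | hq
    · rcases h.isPos_cases hi with hh | hh | hh | hh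
      · omega
      · omega
      -- Here i = θ - j, where θ and j both pair to 1 with α, so u(i) is a difference of two numbers
      -- in {-1, 0}.
      · obtain ⟨j, hj, hjθ, hjα⟩ := h.exists_root_sub hh.2.1
        have h1 := hlin.eq_sub hj
        have h2 := hu1 j (h.isPos_of_pairingIn_pos (by omega)) (by omega)
        omega
      -- The root j and its reflection in i both have u in {-1, 0}, and their values differ by the
      -- nonzero multiple ⟨j, i⟩ of u(i).
      · obtain ⟨j, hjθ, hjα, hji⟩ := h.exists_pairingIn_neg hh.1 hq
        have h1 := hlin.reflectionPerm j i
        have h2 := (rootLinear_pairingIn (P := P) θ).reflectionPerm j i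
        have h3 := (rootLinear_pairingIn (P := P) α).reflectionPerm j i
        simp only [hh.1, hq, hjθ, hjα] at h2 h3
        have h4 := hu1 j (h.isPos_of_pairingIn_pos (by omega)) (by omega)
        have h5 := hu1 _ (h.isPos_of_pairingIn_pos (i := P.reflectionPerm i j) (by omega))
          (by omega)
        rw [h1] at h5
        constructor <;> nlinarith
    · rcases h.isPos_cases hi with hh | hh | hh | hh
      · have := hu1 i hi hh.2.2; omega
      · rw [hh.1, huα]; norm_num
      · have : P.pairingIn ℤ i α = 1 ∨ P.pairingIn ℤ i α = -1 := by omega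
        rcases this with hq | hq
        · have := hu1 i hi hq; omega
        · have := hu2 i hi hq; omega
      · have := hu2 i hi (by omega); omega
  have habs (i : ι) : |u i| ≤ 1 := by
    by_cases hi : b.IsPos i
    · exact habs_pos i hi
    · have := habs_pos _ (isPos_reflectionPerm_self_iff.mpr hi)
      rwa [hlin.reflectionPerm_self, abs_neg] at this
  have h1 := eq_zero_of_mem_corootLattice_of_abs_le_one hmem habs (e i)
  have h2 := hce (e i)
  rw [hui] at h1
  rw [e.symm_apply_apply] at h1 h2
  omega

/-- The root i with e(i) = -θ has ⟨i, θ⟩ = 1, hence is α plus a nonnegative combination of the other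
simple roots, which e keeps positive. Were any of them present, e(α) would have height below that of
-θ, the smallest possible. -/
lemma root_apply_eq_neg (hw : AffineAction P w e n)
    (hpos : ∀ i, b.IsPos i → P.pairingIn ℤ i θ = 0 → b.IsPos (e i))
    (hθ : P.root (e θ) = -P.root α) : P.root (e α) = -P.root θ := by
  classical
  have hheight := (rootLinear_height b).comp hw b
  set i := e.symm (P.reflectionPerm θ θ) with hi
  have hei : e i = P.reflectionPerm θ θ := e.apply_symm_apply _
  have hiθ : P.pairingIn ℤ i θ = 1 := by
    have h1 := hw.pairingIn_of_root_eq_neg (i := i) hθ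
    rw [hei, (rootLinear_pairingIn α).reflectionPerm_self, h.pairing_eq] at h1
    omega
  have hipos : b.IsPos i := h.isPos_of_pairingIn_pos (by omega)
  have hsum := hheight.eq_sum_coeff b i
  simp only [Function.comp_apply] at hsum
  rw [← Finset.add_sum_erase Finset.univ _ (Finset.mem_univ (⟨α, h.mem⟩ : b.support)), h.coeff_eq,
    hiθ, one_mul, hei, (rootLinear_height b).reflectionPerm_self] at hsum
  change _ = b.height (e α) + _ at hsum
  have hlow : -b.height θ ≤ b.height (e α) := by
    have := (rootLinear_height b).le_of_isHighestRoot h.highest (fun j hj ↦ by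
      rw [RootPairing.Base.height_one_of_mem_support hj]; norm_num) (P.reflectionPerm (e α) (e α))
    rw [(rootLinear_height b).reflectionPerm_self] at this
    omega
  have hne (j : b.support) (hj : j ≠ ⟨α, h.mem⟩) : (j : ι) ≠ α := fun hh ↦ hj (Subtype.ext hh)
  have hjpos (j : b.support) (hj : j ≠ ⟨α, h.mem⟩) : 0 < b.height (e j) :=
    b.isPos_iff.mp (hpos j (b.isPos_of_mem_support j.2) (h.pairingIn_highest_of_ne j.2 (hne j hj)))
  have hnonneg (j) (hj : j ∈ Finset.univ.erase (⟨α, h.mem⟩ : b.support)) :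
      0 ≤ coeff b i j * b.height (e j) :=
    mul_nonneg (coeff_nonneg hipos j) (hjpos j (Finset.ne_of_mem_erase hj)).le
  have hzero := (Finset.sum_eq_zero_iff_of_nonneg hnonneg).mp
    (le_antisymm (by omega) (Finset.sum_nonneg hnonneg))
  have hroot : P.root i = P.root α := by
    rw [root_eq_sum_coeff b i, Finset.sum_eq_single ⟨α, h.mem⟩, h.coeff_eq, hiθ, one_smul]
    · intro j _ hj
      have := hzero j (Finset.mem_erase.mpr ⟨hj, Finset.mem_univ _⟩)
      rw [(mul_eq_zero.mp this).resolve_right (hjpos j hj).ne', zero_smul]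
    · simp
  rw [← P.root.injective hroot, hei, root_reflectionPerm_self]

/-- The roots sent to inversions by a minuscule element with rootlet `α` are the roots of degree at
least two. -/
lemma two_le_deg_iff (hw : AffineAction P w e n) (hn : ∀ i, n i = P.pairingIn ℤ i θ)
    (hpos : ∀ i, b.IsPos i → P.pairingIn ℤ i θ = 0 → b.IsPos (e i))
    (hθ : P.root (e θ) = -P.root α) (i : ι) :
    2 ≤ deg b (adjacent b α) i ↔ 2 ≤ n i ∨ n i = 1 ∧ b.IsPos (e i) := by
  have hα := h.root_apply_eq_neg hw hpos hθ
  have h1 := hw.pairingIn_of_root_eq_neg (i := i) hθ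
  have h2 := hw.pairingIn_of_root_eq_neg (i := i) hα
  have h3 := h.deg_eq (e i)
  have h4 := h.deg_eq i
  rw [hn]
  by_cases hi : b.IsPos i
  -- As e exchanges θ and α up to sign, e(i) has degree ⟨i, θ⟩ - 2⟨i, α⟩ and pairs to -⟨i, α⟩ with
  -- θ. When ⟨i, θ⟩ = 1 its sign is therefore decided by whether ⟨i, α⟩ ≤ 0, that is, whether i has
  -- degree at least 2.
  · have hp : P.pairingIn ℤ i α ≤ 0 → P.pairingIn ℤ i θ = 1 → b.IsPos (e i) := fun _ _ ↦
      h.isPos_of_deg_pos (by omega)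
    have hp' : 0 < P.pairingIn ℤ i α → ¬ b.IsPos (e i) := fun _ hp ↦ by
      have := h.pairingIn_nonneg hp
      omega
    rcases h.isPos_cases hi with hh | hh | hh | hh
    · omega
    · have := hp' (by omega)
      simp only [this, and_false, or_false]
      omega
    · by_cases hq : P.pairingIn ℤ i α ≤ 0
      · simp only [hp hq hh.2.1, and_true]; omega
      · simp only [hp' (not_le.mp hq), and_false, or_false]; omega
    · omega
  · have h5 := h.pairingIn_nonneg (isPos_reflectionPerm_self_iff.mpr hi)
    have h6 := h.deg_nonneg (isPos_reflectionPerm_self_iff.mpr hi)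
    rw [(rootLinear_pairingIn θ).reflectionPerm_self] at h5
    rw [(rootLinear_deg b _).reflectionPerm_self] at h6
    omega

/-- The set of roots that belongs to a minuscule element with rootlet `α` is determined. -/
lemma mem_iff_of_isMinusculeFor [P.IsIrreducible] {I : Set ι} (hw : IsMinusculeFor b θ w I)
    (hα : w (alphaZero P θ) + delta K M = rootHat P α) (i : ι) :
    i ∈ I ↔ 2 ≤ deg b (adjacent b α) i := by
  obtain ⟨e, n, hwe⟩ := exists_affineAction hw.1
  obtain ⟨hA, hB, hC⟩ := hwe.inversionSet_eq_iff.mp hw.2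
  obtain ⟨hθ, hnθ⟩ := hwe.apply_alphaZero_iff.mp hα
  have hn := h.translation_eq hwe hA hB hθ hnθ
  refine (hC i).trans (h.two_le_deg_iff hwe hn (fun i hi hi0 ↦ ?_) hθ i).symm
  have := hA i hi
  rw [hn, hi0] at this
  exact (this.resolve_left (by norm_num)).2

end IsFundamentalHighest

end Minuscule

/-! ### Existence of a minuscule element with rootlet α. -/

section Existence

variable {ι K M N : Type*} [Fintype ι] [Field K] [CharZero K] [AddCommGroup M] [Module K M]
  [AddCommGroup N] [Module K N] {P : RootPairing ι K M N} [P.IsCrystallographic] [P.IsReduced]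
  {b : P.Base} {θ α : ι}

lemma exists_mem_affineWeylGroup {x : VHat K M} (hx : x ∈ simpleHat b θ)
    (hne : formHat P x x ≠ 0) : ∃ w ∈ affineWeylGroup b θ,
      (w : VHat K M →ₗ[K] VHat K M) = reflHat P x := by
  have h2 : formHat P x ((2 / formHat P x x) • x) = 2 := by
    rw [map_smul, smul_eq_mul, div_mul_cancel₀ _ hne]
  exact ⟨Module.reflection h2, Subgroup.subset_closure ⟨x, hx, rfl⟩, rfl⟩

lemma exists_affineAction_highest : ∃ w ∈ affineWeylGroup b θ,
    AffineAction P w (P.reflectionPerm θ) (fun i ↦ P.pairingIn ℤ i θ) := by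
  obtain ⟨w, hw, hw'⟩ := exists_mem_affineWeylGroup (b := b) (θ := θ) (x := alphaZero P θ)
    (.inl rfl) (by
      have : P.RootForm (P.root θ) (P.root θ) ≠ 0 :=
          (P.posRootForm ℤ).form_apply_root_ne_zero θ
      simpa [formHat_apply, alphaZero, delta, rootHat] using this)
  exact ⟨w, hw, .of_reflHat_alphaZero hw'⟩

/-- The reflection in a root acts through an element of the affine Weyl group. -/
lemma exists_affineAction_reflectionPerm (i : ι) : ∃ w ∈ affineWeylGroup b θ,
    AffineAction P w (P.reflectionPerm i) 0 := by
  induction i using b.induction_reflect with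
  | h₀ i hi =>
    have : P.reflectionPerm (P.reflectionPerm i i) = P.reflectionPerm i := by
      ext j
      apply P.root.injective
      rw [P.root_reflectionPerm, P.root_reflectionPerm, P.reflection_reflectionPerm]
      simp
    rwa [this]
  | h₁ i hi =>
    obtain ⟨w, hw, hw'⟩ := exists_mem_affineWeylGroup (b := b) (θ := θ) (x := rootHat P i)
      (.inr ⟨i, hi, rfl⟩) (by
        have : P.RootForm (P.root i) (P.root i) ≠ 0 :=
          (P.posRootForm ℤ).form_apply_root_ne_zero i
        simpa [formHat_apply, rootHat] using this)
    exact ⟨w, hw, .of_reflHat_rootHat hw'⟩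
  | h₂ i j hi hj =>
    obtain ⟨w, hw, hw'⟩ := hi
    obtain ⟨v, hv, hv'⟩ := exists_mem_affineWeylGroup (b := b) (θ := θ) (x := rootHat P j)
      (.inr ⟨j, hj, rfl⟩) (by
        have : P.RootForm (P.root j) (P.root j) ≠ 0 :=
          (P.posRootForm ℤ).form_apply_root_ne_zero j
        simpa [formHat_apply, rootHat] using this)
    refine ⟨v * w * v, mul_mem (mul_mem hv hw) hv, ?_⟩
    have : P.reflectionPerm (P.reflectionPerm j i) =
        P.reflectionPerm j * P.reflectionPerm i * P.reflectionPerm j := by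
      ext k
      apply P.root.injective
      simp only [Equiv.Perm.mul_apply, P.root_reflectionPerm, P.reflection_reflectionPerm]
      rfl
    rw [this]
    simpa using! ((AffineAction.of_reflHat_rootHat hv').mul hw').mul
      (AffineAction.of_reflHat_rootHat hv')

/-- The pairings of the positive roots in the kernel of a linear form with a simple root in this
kernel add up to two. -/
lemma sum_pairingIn_eq_two {F : ι → ℤ} (hF : RootLinear P F) {β : ι} (hβ : β ∈ b.support)
    (hFβ : F β = 0) [DecidablePred fun i ↦ b.IsPos i ∧ F i = 0] :
    ∑ i with b.IsPos i ∧ F i = 0, P.pairingIn ℤ i β = 2 := by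
  classical
  set A := Finset.univ.filter fun i ↦ b.IsPos i ∧ F i = 0 with hA
  have hβA : β ∈ A := by simp [hA, b.isPos_of_mem_support hβ, hFβ]
  have hmaps (i : ι) (hi : i ∈ A.erase β) : P.reflectionPerm β i ∈ A.erase β := by
    simp only [hA, Finset.mem_erase, Finset.mem_filter, Finset.mem_univ, true_and] at hi ⊢
    refine ⟨fun hh ↦ ?_, hi.2.1.reflectionPerm hβ hi.1, ?_⟩
    · have h1 : i = P.reflectionPerm β β := by
        rw [← P.reflectionPerm_self β i, hh]
      rw [h1, isPos_reflectionPerm_self_iff] at hi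
      exact hi.2.1 (b.isPos_of_mem_support hβ)
    · rw [hF.reflectionPerm, hFβ, hi.2.2]; simp
  -- The reflection in β permutes the remaining roots and negates their pairings with β, so only β
  -- contributes.
  have hsum : ∑ i ∈ A.erase β, P.pairingIn ℤ i β = ∑ i ∈ A.erase β, -P.pairingIn ℤ i β := by
    refine Finset.sum_bij' (fun i _ ↦ P.reflectionPerm β i) (fun i _ ↦ P.reflectionPerm β i)
      hmaps hmaps (fun i _ ↦ by simp) (fun i _ ↦ by simp) fun i _ ↦ ?_
    rw [(rootLinear_pairingIn β).reflectionPerm, P.pairingIn_same]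
    ring
  rw [Finset.sum_neg_distrib] at hsum
  rw [← Finset.add_sum_erase _ _ hβA, P.pairingIn_same]
  omega

namespace IsFundamentalHighest

variable (h : IsFundamentalHighest b θ α)

include h

/-- The product s_α s_θ s_α works: θ ↦ θ - α ↦ -α ↦ α. -/
lemma exists_affineAction_apply_eq : ∃ e : Equiv.Perm ι,
    (∃ w ∈ affineWeylGroup b θ, AffineAction P w e 0) ∧ e θ = α := by
  obtain ⟨w, hw, hw'⟩ := exists_affineAction_reflectionPerm (b := b) (θ := θ) α
  obtain ⟨v, hv, hv'⟩ := exists_affineAction_reflectionPerm (b := b) (θ := θ) θ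
  refine ⟨_, ⟨w * v * w, mul_mem (mul_mem hw hv) hw, by simpa using! (hw'.mul hv').mul hw'⟩, ?_⟩
  apply P.root.injective
  simp only [Equiv.Perm.mul_apply, P.root_reflectionPerm, P.reflection_apply_root' ℤ, map_sub,
    map_zsmul, one_smul, h.pairing_eq, h.pairingIn_highest, P.pairingIn_same]
  module

/-- Among the finitely many candidates sending θ to α, take one maximising the total height of the
images of the positive roots orthogonal to θ. Composing with the reflection in a simple β ≠ α, which
fixes θ, lowers that total by twice the height of e(β), so this height is nonnegative. -/
lemma exists_affineAction_isPos : ∃ e : Equiv.Perm ι,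
    (∃ w ∈ affineWeylGroup b θ, AffineAction P w e 0) ∧ e θ = α ∧
      ∀ i, b.IsPos i → P.pairingIn ℤ i θ = 0 → b.IsPos (e i) := by
  classical
  obtain ⟨e₀, he₀⟩ := h.exists_affineAction_apply_eq
  obtain ⟨e, ⟨⟨w, hw, hwe⟩, he⟩, hmax⟩ := Set.exists_max_image
    {e : Equiv.Perm ι | (∃ w ∈ affineWeylGroup b θ, AffineAction P w e 0) ∧ e θ = α}
    (fun e ↦ ∑ i with b.IsPos i ∧ P.pairingIn ℤ i θ = 0, b.height (e i)) (Set.toFinite _) ⟨e₀, he₀⟩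
  have hlin := (rootLinear_height b).comp hwe b
  refine ⟨e, ⟨w, hw, hwe⟩, he, ?_⟩
  have hsimple (β : ι) (hβ : β ∈ b.support) (hβα : β ≠ α) : 0 ≤ b.height (e β) := by
    obtain ⟨v, hv, hv'⟩ := exists_affineAction_reflectionPerm (b := b) (θ := θ) β
    have hle := hmax (e * P.reflectionPerm β)
      ⟨⟨w * v, mul_mem hw hv, by simpa using! hwe.mul hv'⟩, by
        rw [Equiv.Perm.mul_apply, P.reflectionPerm_eq_of_pairing_eq_zero, he]
        rw [← P.algebraMap_pairingIn ℤ, h.pairing_zero β hβ hβα, map_zero]⟩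
    have hterm (i : ι) : b.height ((e * P.reflectionPerm β) i) =
        b.height (e i) - P.pairingIn ℤ i β * b.height (e β) := hlin.reflectionPerm i β
    simp only [hterm, Finset.sum_sub_distrib, ← Finset.sum_mul] at hle
    rw [sum_pairingIn_eq_two (rootLinear_pairingIn θ) hβ
      (h.pairingIn_highest_of_ne hβ hβα)] at hle
    omega
  intro i hi hi0
  rw [b.isPos_iff']
  change 0 ≤ (b.height ∘ e) i
  rw [hlin.eq_sum_coeff b]
  refine Finset.sum_nonneg fun j _ ↦ ?_
  by_cases hj : (j : ι) = α
  · rw [show j = ⟨α, h.mem⟩ from Subtype.ext hj, h.coeff_eq, hi0, zero_mul]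
  · exact mul_nonneg (coeff_nonneg hi j) (hsimple j j.2 hj)

/-- The set of roots of degree at least two has a minuscule element with rootlet `α`. -/
lemma exists_isMinusculeFor : ∃ w, IsMinusculeFor b θ w {i | 2 ≤ deg b (adjacent b α) i} ∧
    w (alphaZero P θ) + delta K M = rootHat P α := by
  obtain ⟨t, ⟨v, hv, hvt⟩, htθ, htpos⟩ := h.exists_affineAction_isPos
  obtain ⟨w₀, hw₀, hw₀'⟩ := exists_affineAction_highest (b := b) (θ := θ)
  -- The element is t s₀ with s₀ the reflection in δ - θ: s₀ supplies the translation ⟨·, θ⟩ and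
  -- sends θ to -θ modulo δ, and t moves -θ to -α.
  have hw := hvt.mul hw₀'
  have hθ : P.root ((t * P.reflectionPerm θ) θ) = -P.root α := by
    rw [Equiv.Perm.mul_apply, hvt.root_neg (root_reflectionPerm_self θ), htθ]
  have hn (i : ι) : ((fun i ↦ P.pairingIn ℤ i θ) + (0 : ι → ℤ) ∘ P.reflectionPerm θ) i =
      P.pairingIn ℤ i θ := by simp
  have hpos (i : ι) (hi : b.IsPos i) (hi0 : P.pairingIn ℤ i θ = 0) :
      b.IsPos ((t * P.reflectionPerm θ) i) := by
    rw [Equiv.Perm.mul_apply, P.reflectionPerm_eq_of_pairing_eq_zero]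
    · exact htpos i hi hi0
    · rw [← P.algebraMap_pairingIn ℤ, hi0, map_zero]
  refine ⟨v * w₀, ⟨mul_mem hv hw₀, hw.inversionSet_eq_iff.mpr ⟨fun i hi ↦ ?_, fun i hi ↦ ?_,
    fun i ↦ h.two_le_deg_iff hw hn hpos hθ i⟩⟩, hw.apply_alphaZero_iff.mpr ⟨hθ, ?_⟩⟩
  · rw [hn]
    rcases h.isPos_cases hi with hh | hh | hh | hh
    · omega
    · omega
    · omega
    · exact .inr ⟨hh.1, hpos i hi hh.1⟩
  · rw [hn]
    rcases h.isPos_cases hi with hh | hh | hh | hh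
    · right
      refine ⟨hh.2.1, ?_⟩
      rw [hh.1, isPos_neg_iff hθ, not_not]
      exact b.isPos_of_mem_support h.mem
    all_goals omega
  · rw [hn, P.pairingIn_same]

end IsFundamentalHighest

end Existence

/-! ### Checking bracket inclusions on generators. -/

section LieTransporter

variable {R L : Type*} [CommRing R] [LieRing L] [LieAlgebra R L]

/-- The elements that map `B` into `C` under the adjoint action. -/
def lieTransporter (B C : Submodule R L) : Submodule R L where
  carrier := {x | ∀ y ∈ B, ⁅x, y⁆ ∈ C}
  add_mem' hx hx' y hy := by rw [add_lie]; exact add_mem (hx y hy) (hx' y hy)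
  zero_mem' y _ := by rw [zero_lie]; exact zero_mem C
  smul_mem' c x hx y hy := by rw [smul_lie]; exact C.smul_mem c (hx y hy)

/-- Antisymmetry lets the two arguments be exchanged, so an inclusion of brackets of two suprema can
be reduced to generators in each argument in turn. -/
lemma le_lieTransporter_comm {A B C : Submodule R L} :
    A ≤ lieTransporter B C ↔ B ≤ lieTransporter A C := by
  constructor <;> intro h y hy x hx <;> rw [← lie_skew] <;> exact neg_mem (h hx y hy)

end LieTransporter

/-! ### Root spaces, their brackets, and abelian ideals as sums of root spaces. -/

section RootSubspace

variable {L : Type*} [LieRing L] [LieAlgebra ℂ L] [FiniteDimensional ℂ L]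
  [LieAlgebra.IsSimple ℂ L] {H : LieSubalgebra ℂ L} [H.IsCartanSubalgebra]

lemma exists_mem_rootSubspace_ne_zero (γ : H.root) : ∃ x ∈ rootSubspace γ, x ≠ 0 :=
  (γ : LieModule.Weight ℂ H L).exists_ne_zero

lemma rootSubspace_le_of_mem {γ : H.root} {V : Submodule ℂ L} {x : L} (hx : x ∈ rootSubspace γ)
    (hx0 : x ≠ 0) (hxV : x ∈ V) : rootSubspace γ ≤ V := by
  intro y hy
  obtain ⟨c, hc⟩ := (finrank_eq_one_iff_of_nonzero' (⟨x, hx⟩ : rootSubspace γ)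
    (by simpa using hx0)).mp (finrank_rootSpace_eq_one _ (H.isNonZero_coe_root γ)) ⟨y, hy⟩
  rw [show y = c • x from (congrArg Subtype.val hc).symm]
  exact V.smul_mem c hxV

lemma lie_eq_smul_of_mem_rootSubspace {γ : H.root} {x : L} (hx : x ∈ rootSubspace γ) (h : H) :
    ⁅(h : L), x⁆ = (γ : LieModule.Weight ℂ H L) h • x :=
  lie_eq_smul_of_mem_rootSpace hx h

lemma coe_eq_of_root_eq_neg {γ η : H.root}
    (h : (rootSystem H).root η = -(rootSystem H).root γ) :
    ((η : LieModule.Weight ℂ H L) : H → ℂ) = -((γ : LieModule.Weight ℂ H L) : H → ℂ) := by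
  ext x
  simpa using LinearMap.congr_fun h x

lemma coe_eq_of_root_eq_add {γ η κ : H.root}
    (h : (rootSystem H).root κ = (rootSystem H).root γ + (rootSystem H).root η) :
    ((κ : LieModule.Weight ℂ H L) : H → ℂ) =
      ((γ : LieModule.Weight ℂ H L) : H → ℂ) + ((η : LieModule.Weight ℂ H L) : H → ℂ) := by
  ext x
  simpa using LinearMap.congr_fun h x

/-- The bracket of two root spaces is contained in the root space of the sum. -/
lemma lie_mem_of_forall_rootSubspace_le {γ η : H.root} {x y : L} {C : Submodule ℂ L}
    (hx : x ∈ rootSubspace γ) (hy : y ∈ rootSubspace η)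
    (hne : (rootSystem H).root γ + (rootSystem H).root η ≠ 0)
    (hC : ∀ κ : H.root, (rootSystem H).root κ = (rootSystem H).root γ + (rootSystem H).root η →
      rootSubspace κ ≤ C) : ⁅x, y⁆ ∈ C := by
  have hmem := LieAlgebra.lie_mem_genWeightSpace_of_mem_genWeightSpace hx hy
  by_cases hbot : LieModule.genWeightSpace L (((γ : LieModule.Weight ℂ H L) : H → ℂ) +
      ((η : LieModule.Weight ℂ H L) : H → ℂ)) = ⊥
  · rw [hbot, LieSubmodule.mem_bot] at hmem
    rw [hmem]
    exact zero_mem C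
  · let χ : LieModule.Weight ℂ H L := ⟨_, hbot⟩
    have hχ : χ.IsNonZero := fun h0 ↦ hne (by
      ext z
      exact congrFun h0 z)
    exact hC ⟨χ, by simpa using hχ⟩ (by ext z; simp [χ]) hmem

/-- The bracket of two root spaces is not zero if the sum of the roots is a root. -/
lemma exists_lie_ne_zero {γ η κ : H.root}
    (h : (rootSystem H).root κ = (rootSystem H).root γ + (rootSystem H).root η) :
    ∃ x ∈ rootSubspace γ, ∃ y ∈ rootSubspace η, ⁅x, y⁆ ∈ rootSubspace κ ∧ ⁅x, y⁆ ≠ 0 := by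
  have hcoe := coe_eq_of_root_eq_add h
  obtain ⟨γ, hγ⟩ := γ
  obtain ⟨η, hη⟩ := η
  replace hγ : γ.IsNonZero := by simpa using hγ
  -- Let v be a top vector of the γ-chain through η, r + 1 steps above η, and N the length of the
  -- chain. By sl₂ theory, e f^(r+1) v = (r + 1)(N - r) f^r v, which is nonzero because r + 1 ≤ N.
  obtain ⟨v, hv, hv0⟩ := (LieModule.chainTop γ η).exists_ne_zero
  obtain ⟨h', e, f, ht, he, hf⟩ := exists_isSl2Triple_of_weight_isNonZero hγ
  obtain rfl := ht.h_eq_coroot hγ he hf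
  have hprim : ht.HasPrimitiveVectorWith v (chainLength γ η : ℂ) :=
    have := LieAlgebra.lie_mem_genWeightSpace_of_mem_genWeightSpace he hv
    ⟨hv0, (chainLength_smul _ _ hv).symm, by
      rwa [LieModule.genWeightSpace_add_chainTop _ _ hγ] at this⟩
  obtain ⟨r, hr⟩ : ∃ r, LieModule.chainTopCoeff γ η = r + 1 := by
    refine Nat.exists_eq_succ_of_ne_zero fun h0 ↦ ?_
    have h1 := LieModule.genWeightSpace_add_chainTop (M := L) γ η hγ
    rw [LieModule.coe_chainTop, h0, Nat.cast_zero, zero_smul, zero_add] at h1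
    have h2 := (κ : LieModule.Weight ℂ H L).genWeightSpace_ne_bot
    rw [hcoe] at h2
    exact h2 h1
  have hle := chainTopCoeff_le_chainLength γ η
  refine ⟨e, he, (LieModule.toEnd ℂ L L f ^ (r + 1)) v, ?_, ?_⟩
  · have := LieAlgebra.toEnd_pow_apply_mem hf hv (r + 1)
    rw [LieModule.coe_chainTop', hr] at this
    rwa [smul_neg, neg_add_cancel_left] at this
  · rw [hprim.lie_e_pow_succ_toEnd_f]
    constructor
    · have := LieAlgebra.toEnd_pow_apply_mem hf hv r
      rw [LieModule.coe_chainTop', hr] at this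
      rw [succ_nsmul, smul_neg, add_assoc, neg_add_cancel_left, ← hcoe] at this
      exact Submodule.smul_mem _ _ this
    · refine smul_ne_zero (mul_ne_zero (by exact_mod_cast Nat.succ_ne_zero r) ?_)
        (hprim.pow_toEnd_f_ne_zero_of_eq_nat rfl (by omega))
      rw [sub_ne_zero]
      exact_mod_cast (by omega : chainLength γ η ≠ r)

/-- The root spaces and the Cartan subalgebra are independent. -/
lemma of_rootSubspace_le {γ : H.root} {p : H.root → Prop}
    (h : rootSubspace γ ≤ H.toSubmodule ⊔ ⨆ (η : H.root) (_ : p η), rootSubspace η) : p γ := by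
  by_contra hp
  have hind := (LieModule.iSupIndep_genWeightSpace ℂ H L) (γ : LieModule.Weight ℂ H L)
  rw [← LieSubmodule.disjoint_toSubmodule] at hind
  have hle : H.toSubmodule ⊔ ⨆ (η : H.root) (_ : p η), rootSubspace η ≤
      (⨆ (χ : H → ℂ) (_ : χ ≠ (γ : LieModule.Weight ℂ H L)),
        LieModule.genWeightSpace L χ : LieSubmodule ℂ H L).toSubmodule := by
    refine sup_le ?_ (iSup₂_le fun η hη ↦ ?_)
    · have h0 : (0 : H → ℂ) ≠ (γ : LieModule.Weight ℂ H L) := fun h0 ↦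
        H.isNonZero_coe_root γ h0.symm
      have hle : H.toLieSubmodule ≤ _ := (LieAlgebra.rootSpace_zero_eq ℂ L H).ge.trans
        (le_iSup₂ (f := fun (χ : H → ℂ) (_ : χ ≠ (γ : LieModule.Weight ℂ H L)) ↦
          LieModule.genWeightSpace L χ) 0 h0)
      exact hle
    · have hne : ((η : LieModule.Weight ℂ H L) : H → ℂ) ≠ (γ : LieModule.Weight ℂ H L) :=
        fun h0 ↦ hp (by rwa [← Subtype.ext (DFunLike.coe_injective h0)])
      exact le_iSup₂ (f := fun (χ : H → ℂ) (_ : χ ≠ (γ : LieModule.Weight ℂ H L)) ↦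
          LieModule.genWeightSpace L χ) ((η : LieModule.Weight ℂ H L) : H → ℂ) hne
  obtain ⟨x, hx, hx0⟩ := exists_mem_rootSubspace_ne_zero γ
  exact hx0 (Submodule.disjoint_def.mp hind x hx (hle (h hx)))

/-- A subspace that is stable under the Cartan subalgebra is spanned by root spaces and a subspace
of the Cartan subalgebra. -/
lemma eq_inf_cartan_sup_iSup_rootSubspace {V : Submodule ℂ L} (hV : ∀ h ∈ H, ∀ x ∈ V, ⁅h, x⁆ ∈ V) :
    V = (V ⊓ H.toSubmodule) ⊔ ⨆ (γ : H.root) (_ : rootSubspace γ ≤ V), rootSubspace γ := by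
  refine le_antisymm ?_ (sup_le inf_le_left (iSup₂_le fun _ h ↦ h))
  let N : LieSubmodule ℂ H L := { V with lie_mem := fun {h x} hx ↦ hV h h.2 x hx }
  have hN : N.toSubmodule = V := rfl
  have := congrArg LieSubmodule.toSubmodule (LieModule.eq_iSup_inf_genWeightSpace ℂ H L N)
  rw [hN, LieSubmodule.iSup_toSubmodule] at this
  nth_rw 1 [this]
  refine iSup_le fun χ ↦ ?_
  rw [LieSubmodule.inf_toSubmodule, hN]
  by_cases hχ : χ.IsZero
  · refine le_trans (inf_le_inf_left _ ?_) le_sup_left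
    rw [hχ.eq]
    exact (LieAlgebra.rootSpace_zero_eq ℂ L H).le
  · intro x hx
    by_cases hx0 : x = 0
    · rw [hx0]; exact zero_mem _
    · let γ : H.root := ⟨χ, by simpa using hχ⟩
      exact le_sup_right (a := V ⊓ H.toSubmodule)
        (le_iSup₂ (f := fun (γ : H.root) (_ : rootSubspace γ ≤ V) ↦ rootSubspace γ) γ
          (rootSubspace_le_of_mem (γ := γ) hx.2 hx0 hx.1) hx.2)

lemma cartan_le_borel (b : (rootSystem H).Base) : H.toSubmodule ≤ borel b := le_sup_left

lemma rootSubspace_le_borel {b : (rootSystem H).Base} {γ : H.root} (hγ : b.IsPos γ) :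
    rootSubspace γ ≤ borel b :=
  le_sup_of_le_right (le_iSup₂_of_le γ hγ le_rfl)

/-- For x in the intersection and y in a positive root space, [y, x] lies in the ideal, so [x, [x,
y]] = 0 and γ(x)² = 0. An element of the Cartan subalgebra killed by all roots is 0. -/
lemma IsAbelianIdeal.inf_cartan_eq_bot {b : (rootSystem H).Base} {a : LieSubalgebra ℂ L}
    (ha : IsAbelianIdeal b a) : a.toSubmodule ⊓ H.toSubmodule = ⊥ := by
  rw [eq_bot_iff]
  rintro x ⟨hxa, hxH⟩
  have hpos (γ : H.root) (hγ : b.IsPos γ) : (γ : LieModule.Weight ℂ H L) ⟨x, hxH⟩ = 0 := by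
    obtain ⟨y, hy, hy0⟩ := exists_mem_rootSubspace_ne_zero γ
    have h1 := lie_eq_smul_of_mem_rootSubspace hy ⟨x, hxH⟩
    have h2 := ha.lie_eq_zero x hxa _ (ha.lie_mem y (rootSubspace_le_borel hγ hy) x hxa)
    rw [← lie_skew y x, lie_neg, neg_eq_zero] at h2
    simp only at h1
    rw [h1, lie_smul, h1, smul_smul, smul_eq_zero, mul_self_eq_zero] at h2
    exact h2.resolve_right hy0
  have hall (γ : H.root) : (γ : LieModule.Weight ℂ H L) ⟨x, hxH⟩ = 0 := by
    by_cases hγ : b.IsPos γ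
    · exact hpos γ hγ
    · have h1 := hpos _ (isPos_reflectionPerm_self_iff.mpr hγ)
      have h2 := congrFun (coe_eq_of_root_eq_neg (root_reflectionPerm_self γ)) ⟨x, hxH⟩
      rw [h1] at h2
      simpa using h2
  have hmem : (⟨x, hxH⟩ : H) ∈ ⨅ α : LieModule.Weight ℂ H L, α.ker := by
    rw [Submodule.mem_iInf]
    intro χ
    rw [LieModule.Weight.ker, LinearMap.mem_ker]
    by_cases hχ : χ.IsZero
    · simpa using congrFun hχ.eq ⟨x, hxH⟩
    · exact hall ⟨χ, by simpa using hχ⟩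
  rw [iInf_ker_weight_eq_bot, Submodule.mem_bot] at hmem
  exact congrArg Subtype.val hmem

/-- An abelian ideal of the Borel subalgebra is the sum of its root spaces. -/
lemma IsAbelianIdeal.eq_iSup {b : (rootSystem H).Base} {a : LieSubalgebra ℂ L}
    (ha : IsAbelianIdeal b a) :
    a.toSubmodule = ⨆ (γ : H.root) (_ : γ ∈ rootsOf b a), rootSubspace γ := by
  have h1 := eq_inf_cartan_sup_iSup_rootSubspace (V := a.toSubmodule)
    fun h hh x hx ↦ ha.lie_mem h (cartan_le_borel b hh) x hx
  rw [ha.inf_cartan_eq_bot, bot_sup_eq] at h1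
  refine le_antisymm ?_ (iSup₂_le fun γ hγ ↦ hγ.2)
  nth_rw 1 [h1]
  exact iSup₂_le fun γ hγ ↦ le_iSup₂_of_le γ ⟨of_rootSubspace_le (hγ.trans ha.le_borel), hγ⟩ le_rfl

/-- An abelian ideal of the Borel subalgebra is stable under adding positive roots. -/
lemma IsAbelianIdeal.mem_rootsOf_of_add {b : (rootSystem H).Base} {a : LieSubalgebra ℂ L}
    (ha : IsAbelianIdeal b a) {γ η κ : H.root} (hγ : b.IsPos γ) (hη : η ∈ rootsOf b a)
    (h : (rootSystem H).root κ = (rootSystem H).root γ + (rootSystem H).root η) :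
    κ ∈ rootsOf b a := by
  obtain ⟨x, hx, y, hy, hxy, hne⟩ := exists_lie_ne_zero h
  exact ⟨hγ.add hη.1 h, rootSubspace_le_of_mem hxy hne
    (ha.lie_mem x (rootSubspace_le_borel hγ hx) y (hη.2 hy))⟩

/-- The sum of two roots of an abelian ideal of the Borel subalgebra is not a root. -/
lemma IsAbelianIdeal.root_ne_add {b : (rootSystem H).Base} {a : LieSubalgebra ℂ L}
    (ha : IsAbelianIdeal b a) {γ η : H.root} (hγ : γ ∈ rootsOf b a) (hη : η ∈ rootsOf b a)
    (κ : H.root) :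
    (rootSystem H).root κ ≠ (rootSystem H).root γ + (rootSystem H).root η := fun h ↦ by
  obtain ⟨x, hx, y, hy, -, hne⟩ := exists_lie_ne_zero h
  exact hne (ha.lie_eq_zero x (hγ.2 hx) y (hη.2 hy))

lemma rootSubspace_le_standardLevi_iff {p : LieSubalgebra ℂ L} {γ η : H.root}
    (h : (rootSystem H).root η = -(rootSystem H).root γ) :
    rootSubspace γ ≤ standardLevi (H := H) p ↔
      rootSubspace γ ≤ p.toSubmodule ∧ rootSubspace η ≤ p.toSubmodule := by
  have hη : rootSubspace η = (rootSpace H (-(γ : LieModule.Weight ℂ H L))).toSubmodule := by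
    rw [rootSubspace, coe_eq_of_root_eq_neg h]
  rw [hη]
  exact ⟨fun hle ↦ of_rootSubspace_le (p := fun γ : H.root ↦ rootSubspace γ ≤ p.toSubmodule ∧
    (rootSpace H (-(γ : LieModule.Weight ℂ H L))).toSubmodule ≤ p.toSubmodule) hle,
    fun hγ ↦ le_sup_of_le_right (le_iSup₂_of_le (f := fun (γ : H.root)
      (_ : rootSubspace γ ≤ p.toSubmodule ∧ (rootSpace H (-(γ : LieModule.Weight ℂ H L))).toSubmodule
        ≤ p.toSubmodule) ↦ rootSubspace γ) γ hγ le_rfl)⟩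

lemma gradingGE_eq {b : (rootSystem H).Base} {S : Set H.root} {j : ℤ} (hj : 0 < j) :
    gradingGE b S j = ⨆ (γ : H.root) (_ : j ≤ deg b S γ), rootSubspace γ := by
  refine le_antisymm (iSup₂_le fun i hi ↦ ?_) (iSup₂_le fun γ hγ ↦ ?_)
  · rw [gradingPiece, if_neg (by omega), bot_sup_eq]
    exact iSup₂_le fun γ hγ ↦ le_iSup₂_of_le γ (by omega) le_rfl
  · exact le_iSup₂_of_le _ hγ (le_sup_of_le_right (le_iSup₂_of_le γ rfl le_rfl))

end RootSubspace

/-! ### Brackets and degrees; the subalgebra of degree at least two. -/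

section HighDegree

variable {L : Type*} [LieRing L] [LieAlgebra ℂ L] [FiniteDimensional ℂ L]
  [LieAlgebra.IsSimple ℂ L] {H : LieSubalgebra ℂ L} [H.IsCartanSubalgebra]
  {b : (rootSystem H).Base} {S : Set H.root} {j : ℤ}

lemma lie_mem_gradingGE {i : ℤ} (hij : 0 < i + j) {γ η : H.root}
    (hγ : i ≤ deg b S γ) (hη : j ≤ deg b S η) {x y : L} (hx : x ∈ rootSubspace γ)
    (hy : y ∈ rootSubspace η) : ⁅x, y⁆ ∈ gradingGE b S (i + j) := by
  have hlin := rootLinear_deg b S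
  refine lie_mem_of_forall_rootSubspace_le hx hy (fun h0 ↦ ?_) fun κ hκ ↦ ?_
  · have := hlin.eq_neg (eq_neg_of_add_eq_zero_left h0)
    omega
  · have := hlin.eq_add hκ
    rw [gradingGE_eq hij]
    exact le_iSup₂_of_le κ (by omega) le_rfl

lemma lie_mem_gradingGE_of_mem_cartan (hj : 0 < j) {h y : L} (hh : h ∈ H)
    (hy : y ∈ gradingGE b S j) : ⁅h, y⁆ ∈ gradingGE b S j := by
  suffices gradingGE b S j ≤ lieTransporter H.toSubmodule (gradingGE b S j) from
    le_lieTransporter_comm.mp this hh y hy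
  rw [gradingGE_eq hj]
  refine iSup₂_le fun γ hγ x hx h hh ↦ ?_
  rw [← lie_skew, lie_eq_smul_of_mem_rootSubspace hx ⟨h, hh⟩]
  exact neg_mem (Submodule.smul_mem _ _ 
    (le_iSup₂ (f := fun (γ : H.root) (_ : j ≤ deg b S γ) ↦ rootSubspace γ) γ hγ hx))

lemma lie_mem_gradingGE_of_mem_rootSubspace (hj : 0 < j) {γ : H.root} (hγ : 0 ≤ deg b S γ)
    {x y : L} (hx : x ∈ rootSubspace γ) (hy : y ∈ gradingGE b S j) :
    ⁅x, y⁆ ∈ gradingGE b S j := by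
  suffices gradingGE b S j ≤ lieTransporter (rootSubspace γ) (gradingGE b S j) from
    le_lieTransporter_comm.mp this hx y hy
  conv_lhs => rw [gradingGE_eq hj]
  refine iSup₂_le fun η hη ↦ le_lieTransporter_comm.mp fun x hx y hy ↦ ?_
  have := lie_mem_gradingGE (by omega) hγ hη hx hy
  rwa [zero_add] at this

lemma lie_mem_gradingGE_add {i : ℤ} (hi : 0 < i) (hj : 0 < j) {x y : L}
    (hx : x ∈ gradingGE b S i) (hy : y ∈ gradingGE b S j) : ⁅x, y⁆ ∈ gradingGE b S (i + j) := by
  suffices gradingGE b S i ≤ lieTransporter (gradingGE b S j) (gradingGE b S (i + j)) from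
    this hx y hy
  conv_lhs => rw [gradingGE_eq hi]
  refine iSup₂_le fun γ hγ ↦ le_lieTransporter_comm.mp ?_
  conv_lhs => rw [gradingGE_eq hj]
  exact iSup₂_le fun η hη ↦ le_lieTransporter_comm.mp fun x hx y hy ↦
    lie_mem_gradingGE (by omega) hγ hη hx hy

lemma gradingGE_mono {i : ℤ} (hij : i ≤ j) : gradingGE b S j ≤ gradingGE b S i :=
  iSup₂_le fun k hk ↦ le_iSup₂_of_le k (hij.trans hk) le_rfl

lemma rootSubspace_le_gradingGE_iff (hj : 0 < j) {γ : H.root} :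
    rootSubspace γ ≤ gradingGE b S j ↔ j ≤ deg b S γ := by
  rw [gradingGE_eq hj]
  exact ⟨fun h ↦ of_rootSubspace_le (p := fun γ ↦ j ≤ deg b S γ) (le_sup_of_le_right h),
    fun h ↦ le_iSup₂_of_le γ h le_rfl⟩

variable (b S) in
/-- The subalgebra of elements of degree at least two. -/
def gradingGETwo : LieSubalgebra ℂ L where
  __ := gradingGE b S 2
  lie_mem' hx hy := gradingGE_mono (by norm_num) (lie_mem_gradingGE_add two_pos two_pos hx hy)

lemma gradingGETwo_toSubmodule : (gradingGETwo b S).toSubmodule = gradingGE b S 2 := rfl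

lemma lie_mem_gradingGETwo (hS : ∀ i, b.IsPos i → 0 ≤ deg b S i) {x y : L} (hx : x ∈ borel b)
    (hy : y ∈ gradingGETwo b S) : ⁅x, y⁆ ∈ gradingGETwo b S := by
  suffices borel b ≤ lieTransporter (gradingGE b S 2) (gradingGE b S 2) from this hx y hy
  refine sup_le (fun x hx y hy ↦ lie_mem_gradingGE_of_mem_cartan two_pos hx hy)
    (iSup₂_le fun γ hγ x hx y hy ↦ lie_mem_gradingGE_of_mem_rootSubspace two_pos (hS γ hγ) hx hy)

end HighDegree

/-! ### Assembly: the unique ideal, its maximality, its normaliser and the height. -/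

section Main

variable {L : Type*} [LieRing L] [LieAlgebra ℂ L] [FiniteDimensional ℂ L]
  [LieAlgebra.IsSimple ℂ L] {H : LieSubalgebra ℂ L} [H.IsCartanSubalgebra]
  {b : (rootSystem H).Base} {θ α : H.root}

lemma IsFundamental.isFundamentalHighest (hfund : IsFundamental b θ) (hθ : IsHighestRoot b θ)
    (hα : α ∈ b.support) (hne : (rootSystem H).pairing θ α ≠ 0) : IsFundamentalHighest b θ α := by
  obtain ⟨β, hβ, h1, h0⟩ := hfund
  obtain rfl : α = β := by
    by_contra h
    exact hne (h0 α hα h)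
  refine ⟨hθ, hα, ?_, fun β hβ hne ↦ ?_⟩ <;> apply FaithfulSMul.algebraMap_injective ℤ ℂ <;>
    rw [(rootSystem H).algebraMap_pairingIn]
  · rw [h1, map_one]
  · rw [h0 β hβ hne, map_zero]

namespace IsFundamentalHighest

variable (h : IsFundamentalHighest b θ α)

include h

lemma isAbelianIdeal_gradingGETwo : IsAbelianIdeal b (gradingGETwo b (adjacent b α)) where
  le_borel := by
    rw [gradingGETwo_toSubmodule, gradingGE_eq two_pos]
    exact iSup₂_le fun γ hγ ↦ rootSubspace_le_borel (h.isPos_of_deg_pos (by omega))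
  lie_mem x hx y hy := lie_mem_gradingGETwo (fun _ ↦ h.deg_nonneg) hx hy
  lie_eq_zero x hx y hy := by
    have hxy := lie_mem_gradingGE_add two_pos two_pos hx hy
    have hbot : gradingGE b (adjacent b α) (2 + 2) ≤ ⊥ := by
      rw [gradingGE_eq (by norm_num)]
      refine iSup₂_le fun γ hγ ↦ ?_
      have := h.deg_le_three γ
      omega
    exact (Submodule.mem_bot ℂ).mp (hbot hxy)

lemma rootsOf_gradingGETwo : rootsOf b (gradingGETwo b (adjacent b α)) =
    {γ | 2 ≤ deg b (adjacent b α) γ} := by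
  ext γ
  simp only [rootsOf, gradingGETwo_toSubmodule, rootSubspace_le_gradingGE_iff two_pos,
    Set.mem_ofPred_eq, and_iff_right_iff_imp]
  exact fun hγ ↦ h.isPos_of_deg_pos (by omega)

lemma deg_highest : deg b (adjacent b α) θ = 3 := by
  rw [h.deg_eq, h.pairing_eq, (rootSystem H).pairingIn_same]
  norm_num

lemma gradingGETwo_ne_bot : gradingGETwo b (adjacent b α) ≠ ⊥ := fun h0 ↦ by
  obtain ⟨x, hx, hx0⟩ := exists_mem_rootSubspace_ne_zero θ
  have hmem : x ∈ gradingGETwo b (adjacent b α) :=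
    (rootSubspace_le_gradingGE_iff two_pos).mpr (by rw [h.deg_highest]; norm_num) hx
  rw [h0, LieSubalgebra.mem_bot] at hmem
  exact hx0 hmem

lemma abelianIdealsWithRootlet_eq :
    abelianIdealsWithRootlet b θ α = {gradingGETwo b (adjacent b α)} := by
  ext a
  rw [Set.mem_singleton_iff]
  constructor
  · rintro ⟨ha, -, w, hw, hwα⟩
    apply LieSubalgebra.toSubmodule_injective
    have hroots (γ : H.root) : γ ∈ rootsOf b a ↔ 2 ≤ deg b (adjacent b α) γ :=
      h.mem_iff_of_isMinusculeFor hw hwα γ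
    rw [ha.eq_iSup, gradingGETwo_toSubmodule, gradingGE_eq two_pos]
    simp only [hroots]
  · rintro rfl
    refine ⟨h.isAbelianIdeal_gradingGETwo, h.gradingGETwo_ne_bot, ?_⟩
    rw [IsRootlet, h.rootsOf_gradingGETwo]
    exact h.exists_isMinusculeFor

lemma maximal_gradingGETwo : Maximal (IsAbelianIdeal b) (gradingGETwo b (adjacent b α)) := by
  refine ⟨h.isAbelianIdeal_gradingGETwo, fun a ha hle ↦ ?_⟩
  have hhigh (γ : H.root) (hγ : 2 ≤ deg b (adjacent b α) γ) : γ ∈ rootsOf b a :=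
    ⟨h.isPos_of_deg_pos (by omega), ((rootSubspace_le_gradingGE_iff two_pos).mpr hγ).trans hle⟩
  -- The root θ - γ has degree 3 minus that of γ, so at least 2, and belongs to the ideal; but γ +
  -- (θ - γ) = θ is a root.
  have hsum (γ : H.root) (hγ : γ ∈ rootsOf b a) (hγθ : (rootSystem H).pairingIn ℤ γ θ = 1)
      (hd : deg b (adjacent b α) γ ≤ 1) : False := by
    obtain ⟨η, hη, hηθ, hηα⟩ := h.exists_root_sub hγθ
    rw [h.deg_eq] at hd
    refine ha.root_ne_add hγ (hhigh η ?_) θ (by rw [hη]; abel)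
    rw [h.deg_eq]
    omega
  change a.toSubmodule ≤ (gradingGETwo b (adjacent b α)).toSubmodule
  rw [ha.eq_iSup]
  refine iSup₂_le fun γ hγ ↦ (rootSubspace_le_gradingGE_iff two_pos).mpr ?_
  by_contra! hd
  rcases h.exists_raise hγ.1 (by omega) with hγθ | ⟨j, k, hj, hk, hkθ, hkd⟩
  · exact hsum γ hγ hγθ (by omega)
  · exact hsum k (ha.mem_rootsOf_of_add hj hγ hk) hkθ hkd.le

lemma rootSubspace_le_normalizer {γ : H.root} (hγ : 0 ≤ deg b (adjacent b α) γ) :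
    rootSubspace γ ≤ (gradingGETwo b (adjacent b α)).normalizer.toSubmodule := fun x hx ↦
  (LieSubalgebra.mem_normalizer_iff _ x).mpr fun _ hy ↦
    lie_mem_gradingGE_of_mem_rootSubspace two_pos hγ hx hy

lemma simpleRootsOff_normalizer :
    simpleRootsOff b (gradingGETwo b (adjacent b α)).normalizer = adjacent b α := by
  ext β
  rw [simpleRootsOff, Set.mem_ofPred_eq]
  rw [rootSubspace_le_standardLevi_iff (root_reflectionPerm_self β)]
  constructor
  · rintro ⟨hβ, hnot⟩
    by_contra hadj
    have hdeg : deg b (adjacent b α) β = 0 := by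
      rw [deg]
      refine Finset.sum_eq_zero fun j _ ↦ ?_
      split_ifs with hj
      · rw [coeff_support b ⟨β, hβ⟩ j, if_neg]
        rintro rfl
        exact hadj hj
      · rfl
    refine hnot ⟨h.rootSubspace_le_normalizer hdeg.ge, h.rootSubspace_le_normalizer ?_⟩
    rw [(rootLinear_deg b _).reflectionPerm_self, hdeg, neg_zero]
  · intro hadj
    refine ⟨hadj.1, fun hle ↦ ?_⟩
    -- A nonzero bracket with the root space of -β takes degree 2 to degree 1, so this root space
    -- does not normalise the ideal.
    obtain ⟨i, j, hj, hi⟩ := h.exists_root_sub_adjacent hadj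
    have hdj := (rootLinear_deg b (adjacent b α)).eq_sub hj
    rw [hi, h.deg_adjacent hadj] at hdj
    obtain ⟨x, hx, y, hy, hxy, hne⟩ := exists_lie_ne_zero (γ := (rootSystem H).reflectionPerm β β)
      (η := i) (κ := j)
      (by rw [hj, root_reflectionPerm_self]; abel)
    have hmem := (LieSubalgebra.mem_normalizer_iff _ x).mp (hle.2 hx) y
      ((rootSubspace_le_gradingGE_iff two_pos).mpr hi.ge hy)
    have := (rootSubspace_le_gradingGE_iff two_pos).mp (rootSubspace_le_of_mem hxy hne hmem)
    omega

lemma hasHeight_adjacent : HasHeight b (adjacent b α) 3 := by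
  constructor
  · rw [Set.mem_ofPred_eq, gradingPiece, if_neg (by norm_num), bot_sup_eq]
    intro h0
    obtain ⟨x, hx, hx0⟩ := exists_mem_rootSubspace_ne_zero θ
    exact hx0 (by simpa [h0] using le_iSup₂_of_le (f := fun (γ : H.root)
      (_ : deg b (adjacent b α) γ = 3) ↦ rootSubspace γ) θ h.deg_highest le_rfl hx)
  · intro i hi
    by_contra! hlt
    refine hi ?_
    rw [gradingPiece, if_neg (by omega), bot_sup_eq, eq_bot_iff]
    refine iSup₂_le fun γ hγ ↦ ?_
    have := h.deg_le_three γ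
    omega

end IsFundamentalHighest

end Main

end AbelianIdeals
end

open AbelianIdeals in
theorem theorem4p1 {L : Type*} [LieRing L] [LieAlgebra ℂ L] [FiniteDimensional ℂ L]
    [LieAlgebra.IsSimple ℂ L] (H : LieSubalgebra ℂ L) [H.IsCartanSubalgebra]
    (b : (rootSystem H).Base) (θ : H.root) (hθ : IsHighestRoot b θ) (hfund : IsFundamental b θ)
    (αθ : H.root) (hαθ : αθ ∈ b.support) (hne : (rootSystem H).pairing θ αθ ≠ 0) :
    ∃ a : LieSubalgebra ℂ L,
      abelianIdealsWithRootlet b θ αθ = {a} ∧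
      Maximal (IsAbelianIdeal b) a ∧
      simpleRootsOff b a.normalizer =
        {β | β ∈ b.support ∧ β ≠ αθ ∧ (rootSystem H).pairing β αθ ≠ 0} ∧
      IsLong (rootSystem H) αθ ∧
      coeff b θ ⟨αθ, hαθ⟩ = 2 ∧
      HasHeight b (simpleRootsOff b a.normalizer) 3 ∧
      a.toSubmodule = gradingGE b (simpleRootsOff b a.normalizer) 2 := by
  have h := hfund.isFundamentalHighest hθ hαθ hne
  refine ⟨gradingGETwo b (adjacent b αθ), h.abelianIdealsWithRootlet_eq, h.maximal_gradingGETwo,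
    h.simpleRootsOff_normalizer, h.isLong, ?_, ?_, ?_⟩
  · rw [h.coeff_eq, (rootSystem H).pairingIn_same]
  · rw [h.simpleRootsOff_normalizer]
    exact h.hasHeight_adjacent
  · rw [h.simpleRootsOff_normalizer, gradingGETwo_toSubmodule]
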